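/- Consider one of the following two percolation models, each with mesh size $1$: site percolation on the triangular lattice, with the point $a+b\,e^{i\pi/3}$ written as $(a,b)\in\mathbb Z^2$, or bond percolation on the square lattice $\mathbb Z^2$. Let $p_c=\tfrac12$ be the critical probability, and let $P_p$ be the product measure under which every site (respectively bond) is blue with probability $p$ and yellow otherwise. For integers $m,n\ge1$ let $H(m\times n)$ be the event that there is a blue path inside the rectangle $[0,m]\times[0,n]$ (in the above coordinates, hence a parallelogram in the case of the triangular lattice) from its left side to its right side. For $\varepsilon\in(0,\tfrac12)$ and $p\in(0,1)$ let $$ L_\varepsilon(p) := \begin{cases} \inf\{n\ge1 : P_p[H(n\times n)]\le\varepsilon\} & \text{if } p<p_c,\\ \inf\{n\ge1 : P_p[H(n\times n)]\ge1-\varepsilon\} & \text{if } p>p_c,\end{cases} $$ and $L_\varepsilon(p_c)=\infty$, where $\inf\emptyset=\infty$. Then for all $\varepsilon_0\in(0,\tfrac12)$, $K\ge1$ and $p_0\in(0,p_c)$ there is an $\varepsilon\in(0,\varepsilon_0)$ such that $$ L_\varepsilon(p)\ \ge\ K\cdot L_{\varepsilon_0}(p) $$ for every $p\in(0,p_c)$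 that satisfies $p\ge p_0$ or $L_{\varepsilon_0}(p)>1$. -/

import Mathlib

open MeasureTheory ProbabilityTheory
open scoped ENNReal unitInterval

noncomputable section

namespace Percolation

/-- The triangular lattice with mesh size one. The pair `(a, b)` stands for the point
`a + b * exp (i * π / 3)` of the complex plane, whose six nearest neighbours (at distance one)
are obtained by adding `±1`, `±exp (i * π / 3)` and `±(1 - exp (i * π / 3))`. -/
def triangularLattice : SimpleGraph (ℤ × ℤ) where
  Adj x y := y - x ∈ ({(1, 0), (-1, 0), (0, 1), (0, -1), (1, -1), (-1, 1)} : Set (ℤ × ℤ))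
  symm := ⟨by
    intro x y h
    simp only [Set.mem_insert_iff, Set.mem_singleton_iff, Prod.ext_iff, Prod.fst_sub,
      Prod.snd_sub] at h ⊢
    omega⟩
  loopless := ⟨by
    intro x h
    simp [Prod.ext_iff] at h⟩

/-- The square lattice `ℤ²` with mesh size one. -/
def squareLattice : SimpleGraph (ℤ × ℤ) where
  Adj x y := y - x ∈ ({(1, 0), (-1, 0), (0, 1), (0, -1)} : Set (ℤ × ℤ))
  symm := ⟨by
    intro x y h
    simp only [Set.mem_insert_iff, Set.mem_singleton_iff, Prod.ext_iff, Prod.fst_sub,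
      Prod.snd_sub] at h ⊢
    omega⟩
  loopless := ⟨by
    intro x h
    simp [Prod.ext_iff] at h⟩

/-- The vertices of the `m × n` rectangle `[0, m] × [0, n]`. In the coordinates used for the
triangular lattice this is the parallelogram spanned by `m` and `n * exp (i * π / 3)`. -/
def rectangle (m n : ℕ) : Set (ℤ × ℤ) :=
  {x | (0 ≤ x.1 ∧ x.1 ≤ m) ∧ (0 ≤ x.2 ∧ x.2 ≤ n)}

/-- The product measure `P_p`: the elements of `ι` (sites or bonds) are coloured independently,
each one blue (`true`) with probability `p` and yellow (`false`) with probability `1 - p`. -/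
def productLaw (ι : Type) (p : I) : Measure (ι → Bool) :=
  Measure.infinitePi fun _ : ι => bernoulliMeasure true false p

/-- Site percolation on the triangular lattice: the event that some path of blue sites inside the
`m × n` rectangle connects its left side to its right side. -/
def siteCrossing (m n : ℕ) : Set (ℤ × ℤ → Bool) :=
  {ω | ∃ (x y : ℤ × ℤ) (w : triangularLattice.Walk x y), x.1 = 0 ∧ y.1 = m ∧
    ∀ v ∈ w.support, v ∈ rectangle m n ∧ ω v = true}

/-- Bond percolation on the square lattice: the event that some path of blue bonds inside the
`m × n` rectangle connects its left side to its right side. -/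
def bondCrossing (m n : ℕ) : Set (squareLattice.edgeSet → Bool) :=
  {ω | ∃ (x y : ℤ × ℤ) (w : squareLattice.Walk x y), x.1 = 0 ∧ y.1 = m ∧
    (∀ v ∈ w.support, v ∈ rectangle m n) ∧
    ∀ e : squareLattice.edgeSet, (e : Sym2 (ℤ × ℤ)) ∈ w.edges → ω e = true}

/-- The two percolation models under consideration. -/
inductive Model where
  | triangularSite : Model
  | squareBond : Model

/-- The probability under `P_p` of a horizontal blue crossing of the `m × n` rectangle. -/
def crossingProb (M : Model) (p : I) (m n : ℕ) : ℝ :=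
  match M with
  | .triangularSite => (productLaw (ℤ × ℤ) p).real (siteCrossing m n)
  | .squareBond => (productLaw squareLattice.edgeSet p).real (bondCrossing m n)

/-- The critical probability of both models. -/
def pc : ℝ := 1 / 2

open Classical in
/-- The characteristic length `L_ε(p)`, with values in `{1, 2, …, ∞}`; the infimum of the empty
set is `∞`. -/
def charLength (M : Model) (ε : ℝ) (p : I) : ℕ∞ :=
  if (p : ℝ) < pc then
    sInf {N : ℕ∞ | ∃ n : ℕ, 1 ≤ n ∧ crossingProb M p n n ≤ ε ∧ N = n}
  else if pc < (p : ℝ) then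
    sInf {N : ℕ∞ | ∃ n : ℕ, 1 ≤ n ∧ 1 - ε ≤ crossingProb M p n n ∧ N = n}
  else ⊤

end Percolation

end

/-!
Write `h(j)` for the probability of a crossing of the `j × j` square and let `n + 1` be the
characteristic length `L_ε₀(p)`, so that `h(j) > ε₀` for all `1 ≤ j ≤ n`. The theorem says that
`h(N)` is bounded from below, uniformly in `p`, for all `N ≤ K (n + 1)`. If `n` is bounded, this
holds because `h(N) ≥ p ^ (2 N + 1)` (look at a straight line), and because `p` is bounded away from
zero: if `L_ε₀(p) > 1`, then `ε₀ < h(1) ≤ 2 p`. If `n` is large, it is an instance of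
Russo–Seymour–Welsh theory (`crossingProb_ge`), which turns crossings of squares into crossings of
long rectangles.

Both models are translated into colourings of the cells of a square grid, where blue paths go
through sides of cells. For bond percolation the cells are the vertices, edges and faces of the
lattice, and vertices are always blue, faces always yellow; for site percolation each site is a
brick made up of two cells. In this picture the Russo–Seymour–Welsh inequality
`HorBound.lengthen` can be proved for both models at the same time. The only symmetry used is a
reflection of the rows; crossings of rectangles `[0, w + d] × [-k, k]` and vertical crossings of
rectangles `[0, w] × [0, k]` yield crossings of `[-d, w + d] × [-k, k]`, and this can be repeated
with the same `w` and `k`.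

Its core is `pr_mul_le_two_mul_pr_joins`. Explore the yellow cluster `A` of the left side of
`[0, w] × [0, k]`. If it does not reach the right side, its boundary contains a blue vertical
crossing (`exists_crossing_leftBoundary`), the leftmost one. A horizontal crossing of
`[0, m] × [-k, k]`, where `m > w`, passes from the explored cells or from their mirror image to the
right side through unexplored cells (`HCross.reaches`), and by reflection symmetry it starts with
probability at least one half at the boundary of `A` itself. There it is connected to the leftmost
crossing (`Reaches.joins`), hence to the top side. The conditioning on `A` is harmless because the
colours revealed by `A` and relevant for the remaining cells are blue
(`DeterminedBy.mul_le_real_inter`). The planarity needed is that crossing paths meet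
(`Joined.meet`), which is proved by counting crossings with rays modulo two.

For bond percolation, `h(j) > ε₀` gives horizontal and, by transposition, vertical crossings of
squares, at several scales, which is what the inequality needs. For site percolation it gives
crossings of rhombi, which are horizontal crossings of almost square rectangles of cells
(`horBound_of_crossingProb`) but vertical crossings only of rectangles which are three times as wide
as high (`verBound_of_crossingProb`). Such a vertical crossing either stays in a narrower strip or
crosses a wide strip horizontally (`VCross.exists_strip`). In the second case the horizontal
crossings can be lengthened, in the first case the vertical ones, and both kinds of long crossings
cross large rhombi.
-/

namespace Percolation

/-! ### Connectivity inside a set -/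

/-- `Joined r B u v`: there is a chain `u = z₀, z₁, …, zₙ = v` of points of `B` in which
consecutive points are related by `r`. -/
def Joined {V : Type*} (r : V → V → Prop) (B : Set V) (u v : V) : Prop :=
  u ∈ B ∧ Relation.ReflTransGen (fun a b => r a b ∧ b ∈ B) u v

namespace Joined

variable {V W : Type*} {r : V → V → Prop} {B : Set V} {u v w : V}

lemma left_mem (h : Joined r B u v) : u ∈ B := h.1

lemma right_mem (h : Joined r B u v) : v ∈ B := by
  rcases Relation.ReflTransGen.cases_tail h.2 with h' | ⟨_, _, h'⟩
  · exact h' ▸ h.1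
  · exact h'.2

lemma refl (h : u ∈ B) : Joined r B u u := ⟨h, .refl⟩

lemma tail (h : Joined r B u v) (hr : r v w) (hw : w ∈ B) : Joined r B u w :=
  ⟨h.1, h.2.tail ⟨hr, hw⟩⟩

lemma trans (h : Joined r B u v) (h' : Joined r B v w) : Joined r B u w :=
  ⟨h.1, h.2.trans h'.2⟩

lemma single (hu : u ∈ B) (hr : r u v) (hv : v ∈ B) : Joined r B u v := (refl hu).tail hr hv

/-- Induction along a chain, extending it at its end. -/
lemma rec_tail {P : V → Prop} (h : Joined r B u v) (h0 : P u)
    (step : ∀ a b, Joined r B u a → P a → r a b → b ∈ B → P b) : P v := by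
  obtain ⟨hu, h⟩ := h
  induction h with
  | refl => exact h0
  | tail hab hbc ih => exact step _ _ ⟨hu, hab⟩ ih hbc.1 hbc.2

/-- Chains are carried along by a map which sends related points to joined points. -/
lemma map {r' : W → W → Prop} {B' : Set W} (f : V → W) (h : Joined r B u v)
    (hf : ∀ a ∈ B, f a ∈ B')
    (step : ∀ a ∈ B, ∀ b ∈ B, r a b → Joined r' B' (f a) (f b)) :
    Joined r' B' (f u) (f v) :=
  h.rec_tail (P := fun v => Joined r' B' (f u) (f v)) (refl (hf _ h.1))
    fun a b ha ih hr hb => ih.trans (step a ha.right_mem b hb hr)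

lemma mono {B' : Set V} (h : Joined r B u v) (hB : B ⊆ B') : Joined r B' u v :=
  h.map (r' := r) (B' := B') id (fun _ ha => hB ha) fun _ ha _ hb hr => single (hB ha) hr (hB hb)

lemma symm (hr : ∀ a b, r a b → r b a) (h : Joined r B u v) : Joined r B v u :=
  h.rec_tail (P := fun v => Joined r B v u) (refl h.1)
    fun _ _ ha ih hab hb => (single hb (hr _ _ hab) ha.right_mem).trans ih

/-- A chain lies in the set of the points joined to its starting point. -/
lemma cluster (h : Joined r B u v) : Joined r {z | Joined r B u z} u v :=
  h.rec_tail (P := fun v => Joined r {z | Joined r B u z} u v) (refl (refl h.1))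
    fun _ _ ha ih hab hb => ih.tail hab (ha.tail hab hb)

/-- A chain starting in `D` either stays in `D` or has a first step leaving `D`. -/
lemma exit (D : Set V) (h : Joined r B u v) (hu : u ∈ D) :
    Joined r (B ∩ D) u v ∨
      ∃ x y, Joined r (B ∩ D) u x ∧ r x y ∧ y ∈ B ∧ y ∉ D ∧ Joined r B y v := by
  refine h.rec_tail (P := fun v => Joined r (B ∩ D) u v ∨
      ∃ x y, Joined r (B ∩ D) u x ∧ r x y ∧ y ∈ B ∧ y ∉ D ∧ Joined r B y v)
      (Or.inl (refl ⟨h.1, hu⟩)) ?_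
  rintro a b ha (ih | ⟨x, y, h1, h2, h3, h4, h5⟩) hab hb
  · by_cases hbD : b ∈ D
    · exact Or.inl (ih.tail hab ⟨hb, hbD⟩)
    · exact Or.inr ⟨a, b, ih, hab, hb, hbD, refl hb⟩
  · exact Or.inr ⟨x, y, h1, h2, h3, h4, h5.tail hab hb⟩

lemma exit' (D : Set V) (h : Joined r B u v) (hu : u ∈ D) (hv : v ∉ D) :
    ∃ x y, Joined r (B ∩ D) u x ∧ r x y ∧ y ∈ B ∧ y ∉ D ∧ Joined r B y v :=
  (h.exit D hu).resolve_left fun h' => hv h'.right_mem.2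

/-- A chain along which the integer function `f` changes by at most one in each step, and which
climbs from height at most `c` to height at least `d`, contains a chain crossing the slab
`c ≤ f ≤ d` exactly. -/
lemma slab (hr : ∀ a b, r a b → r b a) (f : V → ℤ) (hf : ∀ a b, r a b → f b ≤ f a + 1)
    {c d : ℤ} (hcd : c ≤ d) (h : Joined r B u v) (hu : f u ≤ c) (hv : d ≤ f v) :
    ∃ u' v', f u' = c ∧ f v' = d ∧ Joined r (B ∩ {z | c ≤ f z ∧ f z ≤ d}) u' v' := by
  obtain ⟨y, hy, hjy⟩ : ∃ y, f y = d ∧ Joined r (B ∩ {z | f z ≤ d}) u y := by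
    by_cases hud : d ≤ f u
    · exact ⟨u, by omega, refl ⟨h.1, by simp only [Set.mem_ofPred_eq]; omega⟩⟩
    · obtain ⟨x, y, hx, hxy, hyB, hyD, -⟩ :=
        h.exit' {z | f z < d} (by simpa using hud) (by simpa using hv)
      have h1 := hf _ _ hxy
      have h2 : f x < d := hx.right_mem.2
      have h3 : ¬ f y < d := hyD
      refine ⟨y, by omega, (hx.mono ?_).tail hxy ⟨hyB, by simp only [Set.mem_ofPred_eq]; omega⟩⟩
      rintro z ⟨hz, hz' : f z < d⟩
      exact ⟨hz, show f z ≤ d from hz'.le⟩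
  have hjy' := hjy.symm hr
  by_cases hyc : f y ≤ c
  · exact ⟨y, y, by omega, hy,
      refl ⟨hjy.right_mem.1, by simp only [Set.mem_ofPred_eq]; omega⟩⟩
  · obtain ⟨x, z, hx, hxz, hzB, hzD, -⟩ :=
      hjy'.exit' {z | c < f z} (by simpa using hyc) (by simpa using hu)
    have h1 := hf _ _ (hr _ _ hxz)
    have h2 : c < f x := hx.right_mem.2
    have h3 : ¬ c < f z := hzD
    have hzB' : f z ≤ d := hzB.2
    refine ⟨z, y, by omega, hy, Joined.symm hr (((hx.mono ?_).tail hxz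
      ⟨hzB.1, by simp only [Set.mem_ofPred_eq]; omega⟩))⟩
    rintro a ⟨⟨ha, ha' : f a ≤ d⟩, ha'' : c < f a⟩
    exact ⟨ha, show c ≤ f a ∧ f a ≤ d from ⟨ha''.le, ha'⟩⟩

end Joined

/-- The cell `a` shares a side with the cell `b`. -/
def Adj4 (a b : ℤ × ℤ) : Prop :=
  (a.2 = b.2 ∧ (a.1 = b.1 + 1 ∨ b.1 = a.1 + 1)) ∨ (a.1 = b.1 ∧ (a.2 = b.2 + 1 ∨ b.2 = a.2 + 1))

/-- The cells `a` and `b` are equal or share a side or a corner. -/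
def Adj8 (a b : ℤ × ℤ) : Prop :=
  (a.1 ≤ b.1 + 1 ∧ b.1 ≤ a.1 + 1) ∧ a.2 ≤ b.2 + 1 ∧ b.2 ≤ a.2 + 1

lemma Adj4.symm {a b : ℤ × ℤ} (h : Adj4 a b) : Adj4 b a := by
  unfold Adj4 at *; omega

lemma Adj8.symm {a b : ℤ × ℤ} (h : Adj8 a b) : Adj8 b a := by
  unfold Adj8 at *; omega

lemma Adj4.adj8 {a b : ℤ × ℤ} (h : Adj4 a b) : Adj8 a b := by
  unfold Adj4 Adj8 at *; omega

lemma Joined.symm4 {B : Set (ℤ × ℤ)} {u v : ℤ × ℤ} (h : Joined Adj4 B u v) : Joined Adj4 B v u :=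
  h.symm fun _ _ => Adj4.symm

/-- The cells of the rectangle `[x₀, x₁] × [y₀, y₁]`. -/
def box (x₀ x₁ y₀ y₁ : ℤ) : Set (ℤ × ℤ) :=
  {z | (x₀ ≤ z.1 ∧ z.1 ≤ x₁) ∧ y₀ ≤ z.2 ∧ z.2 ≤ y₁}

lemma mem_box {x₀ x₁ y₀ y₁ : ℤ} {z : ℤ × ℤ} :
    z ∈ box x₀ x₁ y₀ y₁ ↔ (x₀ ≤ z.1 ∧ z.1 ≤ x₁) ∧ y₀ ≤ z.2 ∧ z.2 ≤ y₁ := Iff.rfl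

/-! ### Planarity: crossing paths meet -/

/-- Contribution of the step from `a` to `b` to the number of times a path crosses the horizontal
ray which starts between the rows `v.2` and `v.2 + 1` and runs to the left from the column of `v`. -/
def rayCount (a b v : ℤ × ℤ) : ZMod 2 :=
  if a.1 = b.1 ∧ a.1 < v.1 ∧ ((a.2 = v.2 ∧ b.2 = v.2 + 1) ∨ (b.2 = v.2 ∧ a.2 = v.2 + 1)) then 1
  else 0

lemma rayCount_same_row {a b v v' : ℤ × ℤ} (hv : v.2 = v'.2) (hvv : v.1 ≤ v'.1 + 1)
    (hvv' : v'.1 ≤ v.1 + 1) (h1 : a ≠ v) (h2 : b ≠ v) (h3 : a ≠ v') (h4 : b ≠ v') :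
    rayCount a b v = rayCount a b v' := by
  unfold rayCount
  rw [Ne, Prod.ext_iff] at h1 h2 h3 h4
  congr 1
  apply propext
  omega

/-- Moving the ray up by one row changes the crossing number by the number of endpoints of the
step lying in the upper of the two rows, to the left of the new position. -/
lemma rayCount_next_row {a b v v' : ℤ × ℤ} (hab : Adj4 a b) (hv : v'.2 = v.2 + 1)
    (hvv : v.1 ≤ v'.1 + 1) (hvv' : v'.1 ≤ v.1 + 1)
    (h1 : a ≠ v) (h2 : b ≠ v) (h3 : a ≠ v') (h4 : b ≠ v') :
    rayCount a b v + rayCount a b v' =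
      (if a.2 = v'.2 ∧ a.1 < v'.1 then 1 else 0) + (if b.2 = v'.2 ∧ b.1 < v'.1 then 1 else 0) := by
  unfold rayCount
  unfold Adj4 at hab
  rw [Ne, Prod.ext_iff] at h1 h2 h3 h4
  split_ifs <;> first | rfl | (exfalso; omega)

/-- The parity of the number of crossings of a path with the left rays, as a function of the
position of the ray. -/
lemma exists_ray_parity {G : Set (ℤ × ℤ)} {u w : ℤ × ℤ} (hG : Joined Adj4 G u w) :
    ∃ f : ℤ × ℤ → ZMod 2,
      (∀ v, (∀ g ∈ G, v.1 ≤ g.1) → f v = 0) ∧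
      (∀ v ∉ G, (∀ g ∈ G, g.1 ≤ v.1) →
        f v = (if u.2 ≤ v.2 then 1 else 0) + (if w.2 ≤ v.2 then 1 else 0)) ∧
      (∀ v ∉ G, ∀ v' ∉ G, v.2 = v'.2 → v.1 ≤ v'.1 + 1 → v'.1 ≤ v.1 + 1 → f v = f v') ∧
      ∀ v ∉ G, ∀ v' ∉ G, v'.2 = v.2 + 1 → v.1 ≤ v'.1 + 1 → v'.1 ≤ v.1 + 1 →
        f v + f v' = (if u.2 = v'.2 ∧ u.1 < v'.1 then 1 else 0) +
          (if w.2 = v'.2 ∧ w.1 < v'.1 then 1 else 0) := by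
  have two : ∀ x : ZMod 2, x + x = 0 := CharTwo.add_self_eq_zero
  refine hG.rec_tail (P := fun w => ∃ f : ℤ × ℤ → ZMod 2,
      (∀ v, (∀ g ∈ G, v.1 ≤ g.1) → f v = 0) ∧
      (∀ v ∉ G, (∀ g ∈ G, g.1 ≤ v.1) →
        f v = (if u.2 ≤ v.2 then 1 else 0) + (if w.2 ≤ v.2 then 1 else 0)) ∧
      (∀ v ∉ G, ∀ v' ∉ G, v.2 = v'.2 → v.1 ≤ v'.1 + 1 → v'.1 ≤ v.1 + 1 → f v = f v') ∧
      ∀ v ∉ G, ∀ v' ∉ G, v'.2 = v.2 + 1 → v.1 ≤ v'.1 + 1 → v'.1 ≤ v.1 + 1 →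
        f v + f v' = (if u.2 = v'.2 ∧ u.1 < v'.1 then 1 else 0) +
          (if w.2 = v'.2 ∧ w.1 < v'.1 then 1 else 0)) ?_ ?_
  · refine ⟨0, fun _ _ => rfl, fun v _ _ => (two _).symm, fun _ _ _ _ _ _ _ => rfl,
      fun _ _ _ _ _ _ _ => ?_⟩
    rw [two]; simp
  · rintro a b ha ⟨f, f1, f2, f3, f4⟩ hab hb
    have ha := ha.right_mem
    refine ⟨fun v => f v + rayCount a b v, ?_, ?_, ?_, ?_⟩
    · intro v hv
      have h := hv a ha
      have : rayCount a b v = 0 := if_neg (by omega)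
      simp only [f1 v hv, this, add_zero]
    · intro v hvG hv
      have h1 := hv a ha
      have h2 := hv b hb
      have h3 : a ≠ v := fun h => hvG (h ▸ ha)
      have h4 : b ≠ v := fun h => hvG (h ▸ hb)
      rw [Ne, Prod.ext_iff] at h3 h4
      have : rayCount a b v =
          (if a.2 ≤ v.2 then 1 else 0) + (if b.2 ≤ v.2 then 1 else 0) := by
        unfold rayCount
        unfold Adj4 at hab
        split_ifs <;> first | rfl | (exfalso; omega)
      simp only [f2 v hvG hv, this]
      rw [add_assoc, ← add_assoc (if a.2 ≤ v.2 then (1 : ZMod 2) else 0), two, zero_add]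
    · intro v hv v' hv' e h h'
      simp only [f3 v hv v' hv' e h h']
      rw [rayCount_same_row e h h' (fun h => hv (h ▸ ha)) (fun h => hv (h ▸ hb))
        (fun h => hv' (h ▸ ha)) (fun h => hv' (h ▸ hb))]
    · intro v hv v' hv' e h h'
      have := rayCount_next_row hab e h h' (fun h => hv (h ▸ ha)) (fun h => hv (h ▸ hb))
        (fun h => hv' (h ▸ ha)) (fun h => hv' (h ▸ hb))
      rw [add_add_add_comm, f4 v hv v' hv' e h h', this, add_assoc,
        ← add_assoc (if a.2 = v'.2 ∧ a.1 < v'.1 then (1 : ZMod 2) else 0), two, zero_add]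

/-- A path of side-adjacent cells from bottom to top meets a path of side- or corner-adjacent
cells from left to right. -/
theorem Joined.meet {G A : Set (ℤ × ℤ)} {u w v₀ v₁ : ℤ × ℤ} (hG : Joined Adj4 G u w)
    (hA : Joined Adj8 A v₀ v₁) (hrow : ∀ a ∈ A, u.2 ≤ a.2 ∧ a.2 ≤ w.2)
    (hcol : ∀ g ∈ G, v₀.1 ≤ g.1 ∧ g.1 ≤ v₁.1) : (G ∩ A).Nonempty := by
  by_contra hne
  have hdisj : ∀ a ∈ A, a ∉ G := fun a ha hg => hne ⟨a, hg, ha⟩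
  -- Extending the vertical path by one cell puts its upper end strictly above all rows of `A`.
  set w' : ℤ × ℤ := (w.1, w.2 + 1) with hw'
  have hw1 : w'.1 = w.1 := rfl
  have hw2 : w'.2 = w.2 + 1 := rfl
  have hG' : Joined Adj4 (insert w' G) u w' :=
    (hG.mono (Set.subset_insert _ _)).tail (Or.inr ⟨rfl, Or.inr rfl⟩) (Set.mem_insert _ _)
  have hdisj' : ∀ a ∈ A, a ∉ insert w' G := by
    rintro a ha (rfl | hg)
    · have := (hrow _ ha).2
      omega
    · exact hdisj a ha hg
  have hcol' : ∀ g ∈ insert w' G, v₀.1 ≤ g.1 ∧ g.1 ≤ v₁.1 := by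
    rintro g (rfl | hg)
    · exact hcol w hG.right_mem
    · exact hcol g hg
  obtain ⟨f, f1, f2, f3, f4⟩ := exists_ray_parity hG'
  have up : ∀ a ∈ A, ∀ b ∈ A, b.2 = a.2 + 1 → a.1 ≤ b.1 + 1 → b.1 ≤ a.1 + 1 → f a = f b := by
    intro a ha b hb e h h'
    have h1 := hrow a ha
    have h2 := hrow b hb
    have := f4 a (hdisj' a ha) b (hdisj' b hb) e h h'
    rw [if_neg (by omega), if_neg (by omega), add_zero] at this
    exact CharTwo.add_eq_zero.mp this
  have key : f v₀ = f v₁ := by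
    refine hA.rec_tail (P := fun v => f v₀ = f v) rfl fun a b ha ih hab hb => ih.trans ?_
    have ha := ha.right_mem
    obtain ⟨⟨h1, h2⟩, h3, h4⟩ := hab
    rcases lt_trichotomy a.2 b.2 with h | h | h
    · exact up a ha b hb (by omega) h1 h2
    · exact f3 a (hdisj' a ha) b (hdisj' b hb) h h1 h2
    · exact (up b hb a ha (by omega) h2 h1).symm
  rw [f1 v₀ fun g hg => (hcol' g hg).1,
    f2 v₁ (hdisj' _ hA.right_mem) fun g hg => (hcol' g hg).2] at key
  have h := hrow v₁ hA.right_mem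
  rw [if_pos h.1, if_neg (by omega)] at key
  simp at key

/-! ### Planarity: the boundary of a set attached to the left side -/

/-- Summing a closed cochain modulo two over the unit squares of a grid leaves only the boundary. -/
lemma sum_boundary_eq_zero (h v : ℕ → ℕ → ZMod 2) (M N : ℕ)
    (hsq : ∀ i < M, ∀ j < N, h i j + h i (j + 1) + v i j + v (i + 1) j = 0) :
    ∑ i ∈ Finset.range M, (h i 0 + h i N) + ∑ j ∈ Finset.range N, (v 0 j + v M j) = 0 := by
  have two : ∀ x : ZMod 2, x + x = 0 := CharTwo.add_self_eq_zero
  have col : ∀ i < M, ∀ n ≤ N,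
      h i 0 + h i n + ∑ j ∈ Finset.range n, (v i j + v (i + 1) j) = 0 := by
    intro i hi n
    induction n with
    | zero => intro _; simp [two]
    | succ n ih =>
      intro hn
      rw [Finset.sum_range_succ]
      linear_combination ih (by omega) + hsq i hi n (by omega) - two (h i n)
  induction M with
  | zero => simp [two]
  | succ M ih =>
    rw [Finset.sum_range_succ]
    have h1 := ih (fun i hi => hsq i (by omega)) (fun i hi => col i (by omega))
    have h2 := col M (by omega) N le_rfl
    have h3 : ∑ j ∈ Finset.range N, (v 0 j + v (M + 1) j) =
        ∑ j ∈ Finset.range N, (v 0 j + v M j) + ∑ j ∈ Finset.range N, (v M j + v (M + 1) j) := by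
      rw [← Finset.sum_add_distrib]
      refine Finset.sum_congr rfl fun j _ => ?_
      linear_combination - two (v M j)
    rw [h3]
    linear_combination h1 + h2

/-- The boundary in `[x₀, x₁] × [y₀, y₁]` of a set `A` of cells together with everything to the
left of the rectangle: the cells outside `A` which lie in the left column or share a side or a
corner with a cell of `A`. -/
def leftBoundary (x₀ x₁ y₀ y₁ : ℤ) (A : Set (ℤ × ℤ)) : Set (ℤ × ℤ) :=
  {z | z ∈ box x₀ x₁ y₀ y₁ ∧ z ∉ A ∧ (z.1 = x₀ ∨ ∃ a ∈ A, Adj8 a z)}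

open Classical in
/-- The indicator of a proposition, modulo two. -/
noncomputable def parity (P : Prop) : ZMod 2 := if P then 1 else 0

lemma parity_true {P : Prop} (h : P) : parity P = 1 := if_pos h

lemma parity_false {P : Prop} (h : ¬P) : parity P = 0 := if_neg h

/-- Around a unit square with corners `p, q, r, s` (where `p, s` and `q, r` are opposite) the number
of sides between a set (capital letters) and a set (small letters) is even, provided the second set
is a union of arcs of the complement of the first one. -/
lemma square_parity {P Q R S p q r s : Prop} (hp : p → ¬P) (hq : q → ¬Q) (hr : r → ¬R)
    (hs : s → ¬S) (hpq : R ∨ S → ¬P → ¬Q → (p ↔ q)) (hrs : P ∨ Q → ¬R → ¬S → (r ↔ s))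
    (hpr : Q ∨ S → ¬P → ¬R → (p ↔ r)) (hqs : P ∨ R → ¬Q → ¬S → (q ↔ s)) :
    (parity (P ∧ q) + parity (Q ∧ p)) + (parity (R ∧ s) + parity (S ∧ r)) +
      (parity (P ∧ r) + parity (R ∧ p)) + (parity (Q ∧ s) + parity (S ∧ q)) = 0 := by
  have e : ∀ X y : Prop, parity (X ∧ y) = parity X * parity y := by
    intro X y
    by_cases h : X <;> by_cases h' : y <;> simp [parity, h, h']
  simp only [e]
  by_cases hP : P <;> by_cases hQ : Q <;> by_cases hR : R <;> by_cases hS : S <;>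
    simp_all [parity_true, parity_false, CharTwo.add_self_eq_zero]
  · linear_combination CharTwo.add_self_eq_zero (parity q + parity r)
  · linear_combination CharTwo.add_self_eq_zero (parity p + parity s)

/-- If `A` does not touch the right side, its left boundary contains a path of side-adjacent cells
from bottom to top. Otherwise let `C` be the part of the boundary joined to the bottom row: the
number of sides between `A` and `C` is even around each vertex of the grid, which is impossible,
because on the bottom row it is odd and elsewhere on the rim of the rectangle it is zero. -/
theorem exists_crossing_leftBoundary {x₀ x₁ y₀ y₁ : ℤ} (hx : x₀ ≤ x₁) (hy : y₀ ≤ y₁)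
    {A : Set (ℤ × ℤ)} (hright : ∀ a ∈ A, a.1 < x₁) :
    ∃ u w, u.2 = y₀ ∧ w.2 = y₁ ∧ Joined Adj4 (leftBoundary x₀ x₁ y₀ y₁ A) u w := by
  by_contra hno
  push Not at hno
  set bd := leftBoundary x₀ x₁ y₀ y₁ A with hbd
  set A' : Set (ℤ × ℤ) := {z | z.1 = x₀ - 1 ∨ z ∈ A} with hA'
  set C : Set (ℤ × ℤ) := {z | ∃ u, u.2 = y₀ ∧ Joined Adj4 bd u z} with hC
  have hCbd : ∀ z ∈ C, z ∈ bd := fun z ⟨u, _, h⟩ => h.right_mem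
  have hbdA : ∀ z ∈ bd, z ∉ A' := by
    rintro z ⟨hz, hzA, -⟩ (h | h)
    · have := hz.1.1; omega
    · exact hzA h
  have hbd' : ∀ z ∈ box x₀ x₁ y₀ y₁, ∀ a ∈ A', Adj8 a z → z ∉ A' → z ∈ bd := by
    intro z hz a ha haz hzA
    refine ⟨hz, fun h => hzA (Or.inr h), ?_⟩
    rcases ha with ha | ha
    · have h1 := haz.1.2; have h2 := hz.1.1
      exact Or.inl (by omega)
    · exact Or.inr ⟨a, ha, haz⟩
  have hCstep : ∀ y z, Adj4 y z → y ∈ bd → z ∈ bd → (y ∈ C ↔ z ∈ C) := by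
    intro y z hyz hy hz
    exact ⟨fun ⟨u, hu, h⟩ => ⟨u, hu, h.tail hyz hz⟩, fun ⟨u, hu, h⟩ => ⟨u, hu, h.tail hyz.symm hy⟩⟩
  have two : ∀ x : ZMod 2, x + x = 0 := CharTwo.add_self_eq_zero
  set e : ℤ × ℤ → ℤ × ℤ → ZMod 2 := fun y z =>
    parity (y ∈ A' ∧ z ∈ C) + parity (z ∈ A' ∧ y ∈ C) with he
  have hCA : ∀ z ∈ C, z ∉ A' := fun z hz => hbdA z (hCbd z hz)
  have pair : ∀ y z, Adj4 y z → (y ∉ A' → y ∈ box x₀ x₁ y₀ y₁) →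
      (z ∉ A' → z ∈ box x₀ x₁ y₀ y₁) → (∃ t ∈ A', Adj8 t y ∧ Adj8 t z) → y ∉ A' → z ∉ A' →
      (y ∈ C ↔ z ∈ C) := by
    rintro y z h hy hz ⟨t, ht, h1, h2⟩ hyA hzA
    exact hCstep y z h (hbd' y (hy hyA) t ht h1 hyA) (hbd' z (hz hzA) t ht h2 hzA)
  have sqr : ∀ p q r s, Adj4 p q → Adj4 r s → Adj4 p r → Adj4 q s → Adj8 p s → Adj8 q r →
      (p ∉ A' → p ∈ box x₀ x₁ y₀ y₁) → (q ∉ A' → q ∈ box x₀ x₁ y₀ y₁) →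
      (r ∉ A' → r ∈ box x₀ x₁ y₀ y₁) → (s ∉ A' → s ∈ box x₀ x₁ y₀ y₁) →
      e p q + e r s + e p r + e q s = 0 := by
    intro p q r s a1 a2 a3 a4 a5 a6 b1 b2 b3 b4
    refine square_parity (hCA p) (hCA q) (hCA r) (hCA s) ?_ ?_ ?_ ?_
    · rintro (h | h)
      · exact pair p q a1 b1 b2 ⟨r, h, a3.adj8.symm, a6.symm⟩
      · exact pair p q a1 b1 b2 ⟨s, h, a5.symm, a4.adj8.symm⟩
    · rintro (h | h)
      · exact pair r s a2 b3 b4 ⟨p, h, a3.adj8, a5⟩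
      · exact pair r s a2 b3 b4 ⟨q, h, a6, a4.adj8⟩
    · rintro (h | h)
      · exact pair p r a3 b1 b3 ⟨q, h, a1.adj8.symm, a6⟩
      · exact pair p r a3 b1 b3 ⟨s, h, a5.symm, a2.adj8.symm⟩
    · rintro (h | h)
      · exact pair q s a4 b2 b4 ⟨p, h, a1.adj8, a5⟩
      · exact pair q s a4 b2 b4 ⟨r, h, a6.symm, a2.adj8⟩
  set M := (x₁ - x₀ + 1).toNat with hM
  set N := (y₁ - y₀).toNat with hN
  set c : ℕ → ℕ → ℤ × ℤ := fun i j => (x₀ - 1 + i, y₀ + j) with hc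
  have hbox : ∀ z ∈ C, z ∈ box x₀ x₁ y₀ y₁ := fun z hz => (hCbd z hz).1
  have cbox : ∀ i j, i ≤ M → j ≤ N → c i j ∉ A' → c i j ∈ box x₀ x₁ y₀ y₁ := by
    intro i j hi hj h
    have : c i j ∈ A' ∨ i ≠ 0 := by
      rcases Nat.eq_zero_or_pos i with rfl | h
      · exact Or.inl (Or.inl (by simp [hc]))
      · exact Or.inr (by omega)
    have := this.resolve_left h
    simp only [hc, mem_box]
    omega
  have sq := sum_boundary_eq_zero (fun i j => e (c i j) (c (i + 1) j))
    (fun i j => e (c i j) (c i (j + 1))) M N ?_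
  · -- The bottom row contributes one, the other three sides nothing.
    have hbot : ∀ i < M, e (c i 0) (c (i + 1) 0) =
        parity (c i 0 ∈ A') + parity (c (i + 1) 0 ∈ A') := by
      intro i hi
      have inC : ∀ i j : ℕ, i ≤ M → c i 0 ∉ A' → c j 0 ∈ A' → Adj8 (c j 0) (c i 0) → c i 0 ∈ C :=
        fun i j hi h1 h2 h3 => ⟨c i 0, by simp [hc],
          .refl (hbd' _ (cbox i 0 hi (Nat.zero_le _) h1) _ h2 h3 h1)⟩
      have adj : Adj8 (c i 0) (c (i + 1) 0) := by
        simp only [Adj8, hc]; push_cast; omega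
      simp only [he]
      by_cases h1 : c i 0 ∈ A' <;> by_cases h2 : c (i + 1) 0 ∈ A'
      · have h3 := fun h => hCA _ h h1
        have h4 := fun h => hCA _ h h2
        rw [parity_false fun h => h4 h.2, parity_false fun h => h3 h.2, parity_true h1, parity_true h2]
        rfl
      · have h4 := inC (i + 1) i (by omega) h2 h1 adj
        simp [parity, h1, h2, h4]
      · have h4 := inC i (i + 1) (by omega) h1 h2 adj.symm
        simp [parity, h1, h2, h4]
      · simp [parity, h1, h2]
    have tele : ∀ m ≤ M, ∑ i ∈ Finset.range m, e (c i 0) (c (i + 1) 0) =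
        parity (c 0 0 ∈ A') + parity (c m 0 ∈ A') := by
      intro m
      induction m with
      | zero => intro _; simp [two]
      | succ m ih =>
        intro hm
        rw [Finset.sum_range_succ, ih (by omega), hbot m (by omega)]
        linear_combination two (parity (c m 0 ∈ A'))
    have htop : ∀ i, e (c i N) (c (i + 1) N) = 0 := by
      intro i
      have h : ∀ i, c i N ∉ C := by
        rintro i ⟨u, hu, h⟩
        refine hno u _ hu ?_ h
        simp only [hc, hN]; omega
      simp [he, parity, h]
    have hleft : ∀ j, e (c 0 j) (c 0 (j + 1)) = 0 := by
      intro j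
      have h : ∀ j, c 0 j ∉ C := fun j h => by
        have := (hbox _ h).1.1
        simp only [hc] at this; push_cast at this; omega
      simp [he, parity, h]
    have hMA : ∀ j, c M j ∉ A' := by
      rintro j (h | h)
      · simp only [hc, hM] at h; omega
      · have := hright _ h
        simp only [hc, hM] at this; omega
    have hright' : ∀ j, e (c M j) (c M (j + 1)) = 0 := by
      intro j
      simp [he, parity, hMA]
    have h00 : c 0 0 ∈ A' := Or.inl (by simp [hc])
    simp only [htop, hleft, hright', add_zero, Finset.sum_const_zero] at sq
    rw [tele M le_rfl, parity_true h00, parity_false (hMA 0)] at sq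
    simp at sq
  · intro i hi j hj
    have a : ∀ i j, Adj4 (c i j) (c (i + 1) j) ∧ Adj4 (c i j) (c i (j + 1)) ∧
        Adj8 (c i j) (c (i + 1) (j + 1)) ∧ Adj8 (c (i + 1) j) (c i (j + 1)) := by
      intro i j
      simp only [Adj4, Adj8, hc]
      push_cast
      simp only [true_and]
      omega
    exact sqr _ _ _ _ (a i j).1 (a i (j + 1)).1 (a i j).2.1 (a (i + 1) j).2.1 (a i j).2.2.1
      (a i j).2.2.2 (cbox i j (by omega) (by omega)) (cbox (i + 1) j (by omega) (by omega))
      (cbox i (j + 1) (by omega) (by omega)) (cbox (i + 1) (j + 1) (by omega) (by omega))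

/-! ### Product measures: correlation of increasing events -/

section Product

variable {ι : Type} {p : I}

instance : IsProbabilityMeasure (productLaw ι p) := by unfold productLaw; infer_instance

/-- The event `E` is determined by the colours of the elements of the finite set `J`. -/
def DeterminedBy (E : Set (ι → Bool)) (J : Finset ι) : Prop :=
  ∀ ω ω', (∀ i ∈ J, ω i = ω' i) → ω ∈ E → ω' ∈ E

lemma DeterminedBy.mono {E : Set (ι → Bool)} {J J' : Finset ι} (h : DeterminedBy E J)
    (hJ : J ⊆ J') : DeterminedBy E J' :=
  fun ω ω' h' => h ω ω' fun i hi => h' i (hJ hi)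

open Classical in
/-- The configuration which agrees with `a` on `J` and is yellow elsewhere. -/
noncomputable def extend (J : Finset ι) (a : J → Bool) : ι → Bool :=
  fun i => if h : i ∈ J then a ⟨i, h⟩ else false

lemma DeterminedBy.eq_preimage {E : Set (ι → Bool)} {J : Finset ι} (h : DeterminedBy E J) :
    E = J.restrict ⁻¹' {a | extend J a ∈ E} := by
  ext ω
  have : ∀ i ∈ J, ω i = extend J (J.restrict ω) i := by
    intro i hi
    simp [extend, hi]
  exact ⟨h _ _ this, h _ _ fun i hi => (this i hi).symm⟩

lemma DeterminedBy.measurableSet {E : Set (ι → Bool)} {J : Finset ι} (h : DeterminedBy E J) :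
    MeasurableSet E := by
  rw [h.eq_preimage]
  exact J.measurable_restrict (MeasurableSet.of_discrete)

open Classical in
lemma DeterminedBy.real_eq_sum {E : Set (ι → Bool)} {J : Finset ι} (h : DeterminedBy E J) :
    (productLaw ι p).real E = ∑ a : J → Bool,
      (∏ i, (bernoulliMeasure true false p).real {a i}) *
        ({a | extend J a ∈ E} : Set (J → Bool)).indicator 1 a := by
  conv_lhs => rw [h.eq_preimage]
  rw [← map_measureReal_apply J.measurable_restrict MeasurableSet.of_discrete]
  unfold productLaw
  rw [Measure.infinitePi_map_restrict]
  have : ({a | extend J a ∈ E} : Set (J → Bool)) =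
      ((Finset.univ.filter fun a => extend J a ∈ E : Finset (J → Bool)) : Set (J → Bool)) := by
    ext; simp
  rw [this, ← sum_measureReal_singleton, Finset.sum_filter]
  refine Finset.sum_congr rfl fun a _ => ?_
  have : (Measure.pi fun _ : J => bernoulliMeasure true false p).real {a} =
      ∏ i, (bernoulliMeasure true false p).real {a i} := by
    rw [measureReal_def, Measure.pi_singleton, ENNReal.toReal_prod]
    rfl
  by_cases ha : extend J a ∈ E <;> simp [ha, this]

/-- Harris' inequality: increasing events are positively correlated. -/
theorem harris {E F : Set (ι → Bool)} {J J' : Finset ι} (hE : DeterminedBy E J)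
    (hF : DeterminedBy F J') (uE : IsUpperSet E) (uF : IsUpperSet F) :
    (productLaw ι p).real E * (productLaw ι p).real F ≤ (productLaw ι p).real (E ∩ F) := by
  classical
  replace hE := hE.mono (Finset.subset_union_left (s₂ := J'))
  replace hF := hF.mono (Finset.subset_union_right (s₁ := J))
  set K := J ∪ J'
  have hEF : DeterminedBy (E ∩ F) K := fun ω ω' h hω => ⟨hE _ _ h hω.1, hF _ _ h hω.2⟩
  have one : ∑ a : K → Bool, ∏ i, (bernoulliMeasure true false p).real {a i} = 1 := by
    have : DeterminedBy (Set.univ : Set (ι → Bool)) K := fun _ _ _ _ => trivial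
    have := this.real_eq_sum (p := p)
    simpa using this.symm
  have ext_mono : ∀ a b : K → Bool, a ≤ b → extend K a ≤ extend K b := by
    intro a b hab i
    unfold extend
    split_ifs with h
    · exact hab _
    · exact le_rfl
  have ind_mono : ∀ G : Set (ι → Bool), IsUpperSet G →
      Monotone (({a | extend K a ∈ G} : Set (K → Bool)).indicator (1 : (K → Bool) → ℝ)) := by
    intro G hG a b hab
    by_cases ha : extend K a ∈ G
    · have hb : extend K b ∈ G := hG (ext_mono a b hab) ha
      simp [ha, hb]
    · rw [Set.indicator_of_notMem (by simpa using ha)]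
      exact Set.indicator_nonneg (fun _ _ => zero_le_one) _
  have nonneg : ∀ G : Set (ι → Bool),
      0 ≤ ({a | extend K a ∈ G} : Set (K → Bool)).indicator (1 : (K → Bool) → ℝ) :=
    fun G => Set.indicator_nonneg fun _ _ => zero_le_one
  have := fkg _ _ (fun a : K → Bool => ∏ i, (bernoulliMeasure true false p).real {a i})
    (fun a => Finset.prod_nonneg fun i _ => measureReal_nonneg) (nonneg E) (nonneg F)
    (ind_mono E uE) (ind_mono F uF) (fun a b => ?_)
  · rw [one, one_mul] at this
    rw [hE.real_eq_sum, hF.real_eq_sum, hEF.real_eq_sum]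
    refine this.trans (le_of_eq (Finset.sum_congr rfl fun a _ => ?_))
    by_cases h1 : extend K a ∈ E <;> by_cases h2 : extend K a ∈ F <;> simp [h1, h2]
  · rw [← Finset.prod_mul_distrib, ← Finset.prod_mul_distrib]
    refine le_of_eq (Finset.prod_congr rfl fun i _ => ?_)
    rw [Pi.inf_apply, Pi.sup_apply]
    rcases a i <;> rcases b i <;> simp [mul_comm]

lemma DeterminedBy.real_inter {E F : Set (ι → Bool)} {J J' : Finset ι} (hE : DeterminedBy E J)
    (hF : DeterminedBy F J') (hJ : Disjoint J J') :
    (productLaw ι p).real (E ∩ F) = (productLaw ι p).real E * (productLaw ι p).real F := by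
  have h := (iIndepFun_infinitePi (P := fun _ : ι => bernoulliMeasure true false p)
    (X := fun _ b => b) (fun _ => measurable_id)).indepFun_finset J J' hJ
    (fun i => measurable_pi_apply i)
  have := h.measure_inter_preimage_eq_mul {a | extend J a ∈ E} {a | extend J' a ∈ F}
    MeasurableSet.of_discrete MeasurableSet.of_discrete
  rw [show (fun (a : ι → Bool) (i : J) => a i) ⁻¹' {a | extend J a ∈ E} = E from
      hE.eq_preimage.symm,
    show (fun (a : ι → Bool) (i : J') => a i) ⁻¹' {a | extend J' a ∈ F} = F from
      hF.eq_preimage.symm] at this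
  simp only [measureReal_def, productLaw, this, ENNReal.toReal_mul]

open Classical in
/-- If the occurrence of `E`, revealed by the colours of `J`, makes it as likely as possible, as
far as these colours are concerned, that the increasing event `F` occurs, then `E` and `F` are
positively correlated. -/
theorem DeterminedBy.mul_le_real_inter {E F : Set (ι → Bool)} {J J' : Finset ι}
    (hE : DeterminedBy E J) (hF : DeterminedBy F J') (uF : IsUpperSet F)
    (h : ∀ ω ∈ E, (fun i => if i ∈ J then true else ω i) ∈ F → ω ∈ F) :
    (productLaw ι p).real E * (productLaw ι p).real F ≤ (productLaw ι p).real (E ∩ F) := by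
  set F' : Set (ι → Bool) := {ω | (fun i => if i ∈ J then true else ω i) ∈ F} with hF'
  have hF'J : DeterminedBy F' (J' \ J) := by
    intro ω ω' hω hωF
    refine hF (fun i => if i ∈ J then true else ω i) (fun i => if i ∈ J then true else ω' i)
      (fun i hi => ?_) hωF
    by_cases hiJ : i ∈ J
    · simp [hiJ]
    · simpa [hiJ] using hω i (Finset.mem_sdiff.mpr ⟨hi, hiJ⟩)
  have hFF' : F ⊆ F' := by
    intro ω hω
    refine uF (fun i => ?_) hω
    by_cases hi : i ∈ J <;> simp [hi]
  calc _ ≤ (productLaw ι p).real E * (productLaw ι p).real F' :=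
        mul_le_mul_of_nonneg_left (measureReal_mono hFF') measureReal_nonneg
    _ = (productLaw ι p).real (E ∩ F') := (hE.real_inter hF'J Finset.disjoint_sdiff).symm
    _ ≤ (productLaw ι p).real (E ∩ F) := by
      refine measureReal_mono ?_
      rintro ω ⟨h1, h2⟩
      exact ⟨h1, h ω h1 h2⟩

end Product

/-! ### Colourings of cells -/

/-- The set of blue cells. The map `π` tells for each cell whose colour it carries: that of an
element of `ℤ × ℤ`, which is random, or always the same colour. -/
def blue (π : ℤ × ℤ → (ℤ × ℤ) ⊕ Bool) (ω : ℤ × ℤ → Bool) : Set (ℤ × ℤ) :=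
  {z | Sum.elim ω id (π z) = true}

/-- The probability that the set of blue cells has the property `Φ`. -/
noncomputable def pr (p : I) (π : ℤ × ℤ → (ℤ × ℤ) ⊕ Bool) (Φ : Set (ℤ × ℤ) → Prop) : ℝ :=
  (productLaw (ℤ × ℤ) p).real {ω | Φ (blue π ω)}

/-- The property `Φ` of a set of cells depends only on the part of this set inside `D`. -/
def LocalOn (D : Set (ℤ × ℤ)) (Φ : Set (ℤ × ℤ) → Prop) : Prop :=
  ∀ b b', b ∩ D = b' ∩ D → Φ b → Φ b'

/-- The elements of `ℤ × ℤ` whose colour is carried by a cell of `D`. -/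
noncomputable def sources (π : ℤ × ℤ → (ℤ × ℤ) ⊕ Bool) {D : Set (ℤ × ℤ)} (hD : D.Finite) :
    Finset (ℤ × ℤ) :=
  ((hD.image π).preimage Sum.inl_injective.injOn).toFinset

section Colour

variable {p : I} {π : ℤ × ℤ → (ℤ × ℤ) ⊕ Bool} {Φ Ψ : Set (ℤ × ℤ) → Prop} {D D' : Set (ℤ × ℤ)}

lemma mem_sources {hD : D.Finite} {i : ℤ × ℤ} :
    i ∈ sources π hD ↔ ∃ z ∈ D, π z = Sum.inl i := by
  simp [sources]

lemma blue_mono {ω ω' : ℤ × ℤ → Bool} (h : ω ≤ ω') : blue π ω ⊆ blue π ω' := by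
  intro z hz
  unfold blue at *
  rcases hπ : π z with i | c
  · simp only [Set.mem_ofPred_eq, hπ, Sum.elim_inl] at hz ⊢
    exact Bool.eq_true_of_true_le (hz ▸ h i)
  · simp only [Set.mem_ofPred_eq, hπ, Sum.elim_inr] at hz ⊢
    exact hz

lemma LocalOn.mono (h : LocalOn D Φ) (hD : D ⊆ D') : LocalOn D' Φ := by
  intro b b' hb
  refine h b b' ?_
  rw [← Set.inter_eq_self_of_subset_right hD, ← Set.inter_assoc, hb, Set.inter_assoc]

lemma LocalOn.determinedBy (h : LocalOn D Φ) (hD : D.Finite) :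
    DeterminedBy {ω | Φ (blue π ω)} (sources π hD) := by
  intro ω ω' hω
  refine h _ _ ?_
  ext z
  simp only [Set.mem_inter_iff, and_congr_left_iff]
  intro hz
  unfold blue
  rcases hπ : π z with i | c
  · simp [hπ, hω i (mem_sources.mpr ⟨z, hz, hπ⟩)]
  · simp [hπ]

lemma isUpperSet_blue (h : Monotone Φ) : IsUpperSet {ω | Φ (blue π ω)} :=
  fun _ _ hω => h (blue_mono hω)

lemma pr_nonneg : 0 ≤ pr p π Φ := measureReal_nonneg

lemma pr_mono (h : ∀ b, Φ b → Ψ b) : pr p π Φ ≤ pr p π Ψ :=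
  measureReal_mono (fun _ hω => h _ hω)

lemma pr_or_le : pr p π (fun b => Φ b ∨ Ψ b) ≤ pr p π Φ + pr p π Ψ :=
  measureReal_union_le _ _

lemma pr_exists_le {α : Type*} (s : Finset α) (F : α → Set (ℤ × ℤ) → Prop) :
    pr p π (fun b => ∃ i ∈ s, F i b) ≤ ∑ i ∈ s, pr p π (F i) := by
  refine le_trans (le_of_eq ?_)
    (measureReal_biUnion_finset_le s fun i => {ω | F i (blue π ω)})
  unfold pr
  congr 1
  ext; simp

lemma pr_mul_le_and (hD : D.Finite) (hD' : D'.Finite) (hΦ : LocalOn D Φ) (hΨ : LocalOn D' Ψ)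
    (mΦ : Monotone Φ) (mΨ : Monotone Ψ) :
    pr p π Φ * pr p π Ψ ≤ pr p π fun b => Φ b ∧ Ψ b :=
  harris (hΦ.determinedBy hD) (hΨ.determinedBy hD') (isUpperSet_blue mΦ) (isUpperSet_blue mΨ)

/-- The map `g` of cells is a symmetry of the random colouring, because the cells carry the
colours of elements of `ℤ × ℤ` which are permuted accordingly. -/
def IsSymmetry (π : ℤ × ℤ → (ℤ × ℤ) ⊕ Bool) (g : ℤ × ℤ → ℤ × ℤ) : Prop :=
  ∃ e : Equiv.Perm (ℤ × ℤ), ∀ z, π (g z) = Sum.map e id (π z)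

lemma productLaw_real_comp (e : Equiv.Perm (ℤ × ℤ)) (E : Set (ℤ × ℤ → Bool)) :
    (productLaw (ℤ × ℤ) p).real {ω | ω ∘ e ∈ E} = (productLaw (ℤ × ℤ) p).real E := by
  let E' : (ℤ × ℤ → Bool) ≃ᵐ (ℤ × ℤ → Bool) :=
    { toEquiv := Equiv.arrowCongr e.symm (Equiv.refl _)
      measurable_toFun := measurable_pi_lambda _ fun i => measurable_pi_apply _
      measurable_invFun := measurable_pi_lambda _ fun i => measurable_pi_apply _ }
  have hE : MeasurePreserving E' (productLaw (ℤ × ℤ) p) (productLaw (ℤ × ℤ) p) :=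
    ⟨E'.measurable, Measure.map_infinitePi_infinitePi_of_inj
      (P := fun _ : ℤ × ℤ => bernoulliMeasure true false p) e.injective⟩
  have := hE.measure_preimage_equiv E
  simp only [measureReal_def, ← this]
  rfl

lemma IsSymmetry.pr_preimage {g : ℤ × ℤ → ℤ × ℤ} (hg : IsSymmetry π g) :
    pr p π (fun b => Φ (g ⁻¹' b)) = pr p π Φ := by
  obtain ⟨e, he⟩ := hg
  have hcol : ∀ ω, blue π (ω ∘ e) = g ⁻¹' blue π ω := by
    intro ω
    ext z
    simp only [blue, Set.mem_preimage, Set.mem_ofPred_eq, he]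
    rcases π z with i | c <;> rfl
  have := productLaw_real_comp (p := p) e {ω | Φ (blue π ω)}
  simp only [Set.mem_ofPred_eq, hcol] at this
  exact this

end Colour

/-! ### Crossings of rectangles -/

lemma box_finite (x₀ x₁ y₀ y₁ : ℤ) : (box x₀ x₁ y₀ y₁).Finite := by
  refine ((Set.finite_Icc x₀ x₁).prod (Set.finite_Icc y₀ y₁)).subset ?_
  rintro z ⟨h, h'⟩
  exact ⟨h, h'⟩

/-- Some path of side-adjacent blue cells inside `D` leads from `U` to `V`. -/
def Joins (D U V b : Set (ℤ × ℤ)) : Prop :=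
  ∃ u ∈ U, ∃ v ∈ V, Joined Adj4 (b ∩ D) u v

section Joins

variable {D U V D' U' V' b : Set (ℤ × ℤ)}

lemma joins_localOn : LocalOn D (Joins D U V) := by
  rintro b b' h ⟨u, hu, v, hv, hj⟩
  exact ⟨u, hu, v, hv, h ▸ hj⟩

lemma joins_monotone : Monotone (Joins D U V) := by
  rintro b b' h ⟨u, hu, v, hv, hj⟩
  exact ⟨u, hu, v, hv, hj.mono (Set.inter_subset_inter_left _ h)⟩

lemma Joins.symm (h : Joins D U V b) : Joins D V U b := by
  obtain ⟨u, hu, v, hv, hj⟩ := h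
  exact ⟨v, hv, u, hu, hj.symm4⟩

lemma Joins.map {b' : Set (ℤ × ℤ)} (g : ℤ × ℤ → ℤ × ℤ) (h : Joins D U V b)
    (hadj : ∀ x y, Adj4 x y → Adj4 (g x) (g y)) (hb : ∀ z ∈ b, g z ∈ b')
    (hD : ∀ z ∈ D, g z ∈ D') (hU : ∀ z ∈ D, z ∈ U → g z ∈ U') (hV : ∀ z ∈ D, z ∈ V → g z ∈ V') :
    Joins D' U' V' b' := by
  obtain ⟨u, hu, v, hv, hj⟩ := h
  have h : ∀ z ∈ b ∩ D, g z ∈ b' ∩ D' := fun z hz => ⟨hb z hz.1, hD z hz.2⟩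
  exact ⟨g u, hU u hj.left_mem.2 hu, g v, hV v hj.right_mem.2 hv,
    hj.map g h fun x hx y hy hxy => .single (h x hx) (hadj x y hxy) (h y hy)⟩

end Joins

/-- A blue horizontal crossing of the rectangle `[x₀, x₁] × [y₀, y₁]` of cells. -/
def HCross (x₀ x₁ y₀ y₁ : ℤ) : Set (ℤ × ℤ) → Prop :=
  Joins (box x₀ x₁ y₀ y₁) {z | z.1 = x₀} {z | z.1 = x₁}

/-- A blue vertical crossing of the rectangle `[x₀, x₁] × [y₀, y₁]` of cells. -/
def VCross (x₀ x₁ y₀ y₁ : ℤ) : Set (ℤ × ℤ) → Prop :=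
  Joins (box x₀ x₁ y₀ y₁) {z | z.2 = y₀} {z | z.2 = y₁}

/-! ### Exploring a rectangle from its left side -/

section Exploration

variable {w k t m s : ℤ} {A b : Set (ℤ × ℤ)}

/-- The blue cells of `[0, w] × [0, k]`, together with the cells of the additional row `k + 1` from
which on the columns are `0, …, t`. A vertical crossing of `[0, w] × [0, k + 1]` in this set is a
blue vertical crossing of `[0, w] × [0, k]` ending in `[0, t] × {k}`. -/
def capped (w k t : ℤ) (b : Set (ℤ × ℤ)) : Set (ℤ × ℤ) :=
  (b ∩ box 0 w 0 k) ∪ {z | z.2 = k + 1 ∧ 0 ≤ z.1 ∧ z.1 ≤ t}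

/-- The cells of `[0, w] × [0, k + 1]` joined to the left side, through sides and corners, outside
`capped w k t b`. -/
def leftCluster (w k t : ℤ) (b : Set (ℤ × ℤ)) : Set (ℤ × ℤ) :=
  {z | ∃ u, u.1 = 0 ∧ Joined Adj8 (box 0 w 0 (k + 1) \ capped w k t b) u z}

lemma leftCluster_subset : leftCluster w k t b ⊆ box 0 w 0 (k + 1) :=
  fun _ ⟨_, _, h⟩ => h.right_mem.1

lemma leftBoundary_leftCluster_subset :
    leftBoundary 0 w 0 (k + 1) (leftCluster w k t b) ⊆ capped w k t b := by
  rintro z ⟨hz, hzA, h⟩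
  by_contra hzB
  refine hzA ?_
  rcases h with h | ⟨a, ⟨u, hu, ha⟩, haz⟩
  · exact ⟨z, h, .refl ⟨hz, hzB⟩⟩
  · exact ⟨u, hu, ha.tail haz ⟨hz, hzB⟩⟩

lemma leftCluster_joined {a : ℤ × ℤ} (ha : a ∈ leftCluster w k t b) :
    ∃ u, u.1 = 0 ∧ Joined Adj8 (leftCluster w k t b) u a := by
  obtain ⟨u, hu, h⟩ := ha
  exact ⟨u, hu, h.cluster.mono fun z hz => ⟨u, hu, hz⟩⟩

/-- If there is a blue vertical crossing ending in `[0, t] × {k}`, then the cluster of the left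
side does not touch the right side. -/
lemma leftCluster_lt
    (h : Joins (box 0 w 0 k) {z | z.2 = 0} {z | z.2 = k ∧ z.1 ≤ t} b) :
    ∀ a ∈ leftCluster w k t b, a.1 < w := by
  obtain ⟨g, hg, g', ⟨hg', hgt⟩, hj⟩ := h
  have hg : g.2 = 0 := hg
  rintro a ⟨u, hu, ha⟩
  have hga := hj.right_mem.2
  rw [mem_box] at hga
  by_contra haw
  have haw' := ha.right_mem.1.1
  set G : Set (ℤ × ℤ) := insert (g'.1, k + 1) (b ∩ box 0 w 0 k)
  have hG : Joined Adj4 G g (g'.1, k + 1) :=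
    (hj.mono (Set.subset_insert _ _)).tail (Or.inr ⟨rfl, Or.inr (by simp [hg'])⟩)
      (Set.mem_insert _ _)
  obtain ⟨z, hzG, hz⟩ := hG.meet ha
    (fun z hz => by have := hz.1.2; simp only; omega)
    (by
      rintro z (rfl | hz)
      · simp only; omega
      · have := hz.2.1; omega)
  refine hz.2 ?_
  rcases hzG with rfl | hzG
  · exact Or.inr ⟨rfl, hga.1.1, hgt⟩
  · exact Or.inl hzG

/-- Whether `A` is the cluster of the left side depends only on the colours in `A` and on its left
boundary. -/
lemma leftCluster_localOn :
    LocalOn ((A ∪ leftBoundary 0 w 0 (k + 1) A) ∩ box 0 w 0 k)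
      (fun b => leftCluster w k t b = A) := by
  rintro b b' h rfl
  set A := leftCluster w k t b with hA
  have hbd : leftBoundary 0 w 0 (k + 1) A ⊆ capped w k t b := leftBoundary_leftCluster_subset
  have same : ∀ z ∈ A ∪ leftBoundary 0 w 0 (k + 1) A, (z ∈ capped w k t b ↔ z ∈ capped w k t b') := by
    intro z hz
    refine or_congr ?_ Iff.rfl
    constructor
    · rintro ⟨h1, h2⟩
      have : z ∈ b ∩ ((A ∪ leftBoundary 0 w 0 (k + 1) A) ∩ box 0 w 0 k) := ⟨h1, hz, h2⟩
      exact ⟨(h ▸ this).1, h2⟩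
    · rintro ⟨h1, h2⟩
      have : z ∈ b' ∩ ((A ∪ leftBoundary 0 w 0 (k + 1) A) ∩ box 0 w 0 k) := ⟨h1, hz, h2⟩
      exact ⟨(h ▸ this).1, h2⟩
  have step : ∀ z ∈ box 0 w 0 (k + 1) \ capped w k t b', (z.1 = 0 ∨ ∃ a ∈ A, Adj8 a z) → z ∈ A := by
    rintro z ⟨hz, hzB⟩ hza
    by_contra hzA
    have hz' : z ∈ leftBoundary 0 w 0 (k + 1) A := ⟨hz, hzA, hza⟩
    exact hzB ((same z (Or.inr hz')).mp (hbd hz'))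
  apply Set.Subset.antisymm
  · rintro z ⟨u, hu, hz⟩
    exact hz.rec_tail (P := fun z => z ∈ A) (step u hz.left_mem (Or.inl hu))
      fun x y _ hx hxy hy => step y hy (Or.inr ⟨x, hx, hxy⟩)
  · rintro z ⟨u, hu, hz⟩
    refine ⟨u, hu, ?_⟩
    have hAB : ∀ z ∈ A, z ∈ box 0 w 0 (k + 1) \ capped w k t b' := by
      rintro z hz
      have hz' := hz
      obtain ⟨v, _, hv⟩ := hz'
      exact ⟨hv.right_mem.1, fun h => hv.right_mem.2 ((same z (Or.inl hz)).mpr h)⟩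
    exact (hz.cluster.mono fun y hy => ⟨u, hu, hy⟩ : Joined Adj8 A u z).mono hAB

/-- The reflection of the rows which exchanges the rows `0` and `-s`. -/
def rowReflection (s : ℤ) (z : ℤ × ℤ) : ℤ × ℤ := (z.1, -s - z.2)

/-- The cells of `[0, m] × [-k - s, k]` which neither belong to `A` and its left boundary nor to
the mirror images of these sets. -/
def unexplored (m w k s : ℤ) (A : Set (ℤ × ℤ)) : Set (ℤ × ℤ) :=
  {z | z ∈ box 0 m (-k - s) k ∧ z ∉ A ∪ leftBoundary 0 w 0 (k + 1) A ∧
    rowReflection s z ∉ A ∪ leftBoundary 0 w 0 (k + 1) A}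

/-- A blue path in the unexplored cells leads from a neighbour of the left boundary of `A` to the
right side of `[0, m] × [-k - s, k]`. -/
def Reaches (m w k s : ℤ) (A b : Set (ℤ × ℤ)) : Prop :=
  ∃ z ∈ leftBoundary 0 w 0 (k + 1) A, z.2 ≤ k ∧ ∃ q, Adj4 z q ∧ ∃ r, r.1 = m ∧
    Joined Adj4 (b ∩ unexplored m w k s A) q r

lemma rowReflection_unexplored {z : ℤ × ℤ} (hz : z ∈ unexplored m w k s A) :
    rowReflection s z ∈ unexplored m w k s A := by
  obtain ⟨h1, h2, h3⟩ := hz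
  refine ⟨?_, h3, ?_⟩
  · simp only [mem_box, rowReflection] at *; omega
  · simpa [rowReflection] using h2

/-- A path of cells is folded into the upper half plane by reflecting its cells below it. -/
lemma joined_fold (hs : s = 0 ∨ s = 1) {q r : ℤ × ℤ}
    (h : Joined Adj4 (b ∩ unexplored m w k s A) q r) :
    ∃ q' r', (q' = q ∨ q' = rowReflection s q ∧ q.2 < 0) ∧ 0 ≤ q'.2 ∧ r'.1 = r.1 ∧
      Joined Adj8 (unexplored m w k s A ∩ {z | 0 ≤ z.2}) q' r' := by
  classical
  set f : ℤ × ℤ → ℤ × ℤ := fun z => if z.2 < 0 then rowReflection s z else z with hf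
  have f1 : ∀ z, (f z).1 = z.1 := by
    intro z; simp only [hf]; split_ifs <;> rfl
  have f2 : ∀ z, (f z).2 = if z.2 < 0 then -s - z.2 else z.2 := by
    intro z; simp only [hf]; split_ifs <;> rfl
  have hfD : ∀ z ∈ b ∩ unexplored m w k s A, f z ∈ unexplored m w k s A ∩ {z | 0 ≤ z.2} := by
    rintro z ⟨-, hz⟩
    constructor
    · by_cases h : z.2 < 0
      · simpa only [hf, if_pos h] using rowReflection_unexplored hz
      · simpa only [hf, if_neg h] using hz
    · change 0 ≤ (f z).2
      rw [f2]; split_ifs <;> omega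
  refine ⟨f q, f r, ?_, (hfD q h.left_mem).2, f1 r,
    h.map f hfD fun x hx y hy hxy => .single (hfD x hx) ?_ (hfD y hy)⟩
  · by_cases h : q.2 < 0
    · exact Or.inr ⟨by simp only [hf, if_pos h], h⟩
    · exact Or.inl (by simp only [hf, if_neg h])
  · unfold Adj4 at hxy
    unfold Adj8
    rw [f1, f1, f2, f2]
    split_ifs <;> omega

/-- If the cluster `A` of the left side does not touch the right side and `Reaches` occurs, then
the right side of `[0, m] × [-k - s, k]` is joined to `[0, t] × {k}`: the left boundary of `A`
contains a vertical crossing, and the cell from which the right side is reached must lie on it. -/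
lemma Reaches.joins (hs : s = 0 ∨ s = 1) (hk : 0 ≤ k) (hw : 0 ≤ w) (hwm : w < m)
    (hA : leftCluster w k t b = A) (hAw : ∀ a ∈ A, a.1 < w) (h : Reaches m w k s A b) :
    Joins (box 0 m (-k - s) k) {z | z.2 = k ∧ z.1 ≤ t} {z | z.1 = m} b := by
  obtain ⟨z, hz, hzk, q, hzq, r, hr, hqr⟩ := h
  obtain ⟨u, v, hu, hv, huv⟩ := exists_crossing_leftBoundary (y₀ := 0) (y₁ := k + 1) hw
    (by omega) hAw
  have hbd : leftBoundary 0 w 0 (k + 1) A ⊆ capped w k t b := hA ▸ leftBoundary_leftCluster_subset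
  have hzS := hz.1
  rw [mem_box] at hzS
  obtain ⟨q', r', hq', hq'0, hr', hq'r'⟩ := joined_fold hs hqr
  have hzq' : Adj8 z q' := by
    unfold Adj4 at hzq
    unfold Adj8
    rcases hq' with rfl | ⟨rfl, hq⟩
    · omega
    · simp only [rowReflection] at *; omega
  -- `z` belongs to the crossing contained in the boundary
  have huz : Joined Adj4 (leftBoundary 0 w 0 (k + 1) A) u z := by
    set Z : Set (ℤ × ℤ) := A ∪ {z} ∪ (unexplored m w k s A ∩ {z | 0 ≤ z.2}) with hZ
    have hzZ : z ∈ Z := Or.inl (Or.inr rfl)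
    have hright : Joined Adj8 Z z r' :=
      (Joined.single hzZ hzq' (Or.inr hq'r'.left_mem)).trans
        (hq'r'.mono Set.subset_union_right)
    obtain ⟨v₀, hv₀, hleft⟩ : ∃ v₀, v₀.1 = 0 ∧ Joined Adj8 Z v₀ r' := by
      rcases hz.2.2 with h0 | ⟨a, ha, haz⟩
      · exact ⟨z, h0, hright⟩
      · obtain ⟨v₀, hv₀, hj⟩ := leftCluster_joined (hA.symm ▸ ha)
        rw [hA] at hj
        exact ⟨v₀, hv₀, ((hj.mono fun x hx => Or.inl (Or.inl hx)).tail haz hzZ).trans hright⟩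
    obtain ⟨x, hx1, hx2⟩ := huv.cluster.meet hleft
      (by
        rintro x ((hx | rfl) | hx)
        · have := (leftCluster_subset (hA.symm ▸ hx)).2; omega
        · omega
        · have h1 := hx.1.1.2; have h2 : 0 ≤ x.2 := hx.2; omega)
      (by
        intro x hx
        have := hx.right_mem.1.1
        omega)
    have hxbd := hx1.right_mem
    rcases hx2 with (hx | rfl) | hx
    · exact absurd hx hxbd.2.1
    · exact hx1
    · exact absurd (Or.inr hxbd) hx.1.2.1
  -- following the crossing upwards from `z`, stop below the additional row
  have hzv : Joined Adj4 (capped w k t b) z v := (huz.symm4.trans huv).mono hbd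
  obtain ⟨x, y, hzx, hxy, hyB, hyk, -⟩ := hzv.exit' {c : ℤ × ℤ | c.2 ≤ k} hzk
    (by simp only [Set.mem_ofPred_eq]; omega)
  have hyk' : ¬ y.2 ≤ k := hyk
  have hxk : x.2 ≤ k := hzx.right_mem.2
  have hy : y.2 = k + 1 ∧ 0 ≤ y.1 ∧ y.1 ≤ t := by
    rcases hyB with hy | hy
    · exact absurd hy.2.2.2 hyk'
    · exact hy
  have hsub : capped w k t b ∩ {z | z.2 ≤ k} ⊆ b ∩ box 0 m (-k - s) k := by
    rintro c ⟨⟨hcb, hc⟩ | hc, hck⟩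
    · refine ⟨hcb, ?_⟩
      rw [mem_box] at *
      omega
    · have h1 : c.2 ≤ k := hck
      have h2 : c.2 = k + 1 := hc.1
      omega
  have hzx' := hzx.mono hsub
  have hqr' : Joined Adj4 (b ∩ box 0 m (-k - s) k) q r :=
    hqr.mono fun c hc => ⟨hc.1, hc.2.1⟩
  refine ⟨x, ⟨?_, ?_⟩, r, hr, (hzx'.symm4.tail hzq hqr'.left_mem).trans hqr'⟩ <;>
  · unfold Adj4 at hxy
    omega

/-- The boundary of `A` separates `A` from the unexplored cells. -/
lemma not_adj4_unexplored (hs : s = 0 ∨ s = 1) (hA : A ⊆ box 0 w 0 (k + 1))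
    (hAw : ∀ a ∈ A, a.1 < w) {a q : ℤ × ℤ} (ha : a ∈ A)
    (hq : q ∈ unexplored m w k s A) : ¬Adj4 a q := by
  intro haq
  have hN : ∀ z ∈ box 0 w 0 (k + 1), Adj8 a z → z ∈ A ∪ leftBoundary 0 w 0 (k + 1) A :=
    fun z hz haz => or_iff_not_imp_left.mpr fun hzA => ⟨hz, hzA, Or.inr ⟨a, ha, haz⟩⟩
  have h1 := hAw a ha
  have h2 := hA ha
  have h3 := hq.1
  rw [mem_box] at h2 h3
  have haq' := haq
  unfold Adj4 at haq
  by_cases h0 : 0 ≤ q.2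
  · refine hq.2.1 (hN q ?_ haq'.adj8)
    rw [mem_box]; omega
  · refine hq.2.2 (hN _ ?_ ?_)
    · rw [mem_box]; simp only [rowReflection]; omega
    · unfold Adj8; simp only [rowReflection]; omega

/-- A horizontal crossing of `[0, m] × [-k - s, k]` has to leave the set explored from the left
side of the upper half and the mirror image of this set through one of their boundaries. -/
lemma HCross.reaches (hs : s = 0 ∨ s = 1) (hw : 0 ≤ w) (hwm : w < m)
    (hA : A ⊆ box 0 w 0 (k + 1)) (hAw : ∀ a ∈ A, a.1 < w)
    (h : HCross 0 m (-k - s) k b) :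
    Reaches m w k s A b ∨ Reaches m w k s A (rowReflection s ⁻¹' b) := by
  obtain ⟨u, hu, r, hr, hur⟩ := h
  have hu : u.1 = 0 := hu
  have hr : r.1 = m := hr
  set N := A ∪ leftBoundary 0 w 0 (k + 1) A with hN
  have hNbox : ∀ z ∈ N, z ∈ box 0 w 0 (k + 1) := by
    rintro z (hz | hz)
    · exact hA hz
    · exact hz.1
  have hN0 : ∀ z ∈ box 0 w 0 (k + 1), z.1 = 0 → z ∈ N := fun z hz h0 =>
    or_iff_not_imp_left.mpr fun hzA => ⟨hz, hzA, Or.inl h0⟩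
  have hrN : r ∈ {z | z ∉ N ∧ rowReflection s z ∉ N} := by
    constructor <;> intro h
    · have := (hNbox _ h).1; omega
    · have := (hNbox _ h).1; simp only [rowReflection] at this; omega
  have huN : u ∉ {z | z ∉ N ∧ rowReflection s z ∉ N} := by
    rintro ⟨h1, h2⟩
    have huR := hur.left_mem.2
    rw [mem_box] at huR
    by_cases h0 : 0 ≤ u.2
    · refine h1 (hN0 u ?_ hu)
      rw [mem_box]; omega
    · refine h2 (hN0 _ ?_ hu)
      rw [mem_box]; simp only [rowReflection]; omega
  obtain ⟨q, z, hrq, hqz, hzR, hzN, -⟩ := hur.symm4.exit' _ hrN huN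
  have hQ : ∀ c ∈ b ∩ box 0 m (-k - s) k ∩ {z | z ∉ N ∧ rowReflection s z ∉ N},
      c ∈ b ∩ unexplored m w k s A := fun c hc => ⟨hc.1.1, hc.1.2, hc.2⟩
  have hqr := (hrq.mono hQ).symm4
  have key : ∀ z q, z ∈ N → Adj4 z q → q ∈ unexplored m w k s A →
      z ∈ leftBoundary 0 w 0 (k + 1) A := fun z q hz hzq hq =>
    hz.resolve_left fun hzA => not_adj4_unexplored hs hA hAw hzA hq hzq
  have hzk := hzR.2
  rw [mem_box] at hzk
  by_cases hz : z ∈ N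
  · refine Or.inl ⟨z, key z q hz hqz.symm hqr.left_mem.2, by omega, q, hqz.symm, r,
      hr, hqr⟩
  · have hz' : rowReflection s z ∈ N := by
      by_contra h
      exact hzN ⟨hz, h⟩
    have hadj : ∀ x y, Adj4 x y → Adj4 (rowReflection s x) (rowReflection s y) := by
      intro x y hxy
      unfold Adj4 at *
      simp only [rowReflection]
      omega
    have hmem : ∀ c ∈ b ∩ unexplored m w k s A,
        rowReflection s c ∈ rowReflection s ⁻¹' b ∩ unexplored m w k s A := by
      rintro c ⟨hc1, hc2⟩
      exact ⟨by simpa [rowReflection] using hc1, rowReflection_unexplored hc2⟩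
    have hqr' := hqr.map (r' := Adj4) (rowReflection s) hmem
      fun x hx y hy hxy => .single (hmem x hx) (hadj x y hxy) (hmem y hy)
    have hle : (rowReflection s z).2 ≤ k := by simp only [rowReflection]; omega
    exact Or.inr ⟨_, key _ _ hz' (hadj _ _ hqz.symm) hqr'.left_mem.2, hle,
      _, hadj _ _ hqz.symm, rowReflection s r, hr, hqr'⟩

end Exploration

section Exploration

variable {w k t m s : ℤ} {p : I} {π : ℤ × ℤ → (ℤ × ℤ) ⊕ Bool}

lemma reaches_monotone {A : Set (ℤ × ℤ)} : Monotone (Reaches m w k s A) := by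
  rintro b b' h ⟨z, hz, hzk, q, hzq, r, hr, hqr⟩
  exact ⟨z, hz, hzk, q, hzq, r, hr, hqr.mono (Set.inter_subset_inter_left _ h)⟩

lemma reaches_localOn {A : Set (ℤ × ℤ)} :
    LocalOn (unexplored m w k s A) (Reaches m w k s A) := by
  rintro b b' h ⟨z, hz, hzk, q, hzq, r, hr, hqr⟩
  exact ⟨z, hz, hzk, q, hzq, r, hr, h ▸ hqr⟩

/-- Cells which carry the colour of the same element are next to each other. -/
def Clustered (π : ℤ × ℤ → (ℤ × ℤ) ⊕ Bool) : Prop :=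
  ∀ z z' i, π z = Sum.inl i → π z' = Sum.inl i → z = z' ∨ Adj4 z z'

open Classical in
/-- Exploring the cluster `A` of the left side is favourable for `Reaches`: the colours which are
revealed and matter for the unexplored cells are blue, since a cell with the same colour as a cell
of `A` is explored. -/
lemma pr_mul_le_pr_leftCluster_and_reaches (hπ : Clustered π) {A : Set (ℤ × ℤ)}
    (hs : s = 0 ∨ s = 1) (hA : A ⊆ box 0 w 0 (k + 1)) (hAw : ∀ a ∈ A, a.1 < w) :
    pr p π (fun b => leftCluster w k t b = A) * pr p π (Reaches m w k s A) ≤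
      pr p π fun b => leftCluster w k t b = A ∧ Reaches m w k s A b := by
  have hD : ((A ∪ leftBoundary 0 w 0 (k + 1) A) ∩ box 0 w 0 k).Finite :=
    (box_finite _ _ _ _).subset Set.inter_subset_right
  have hD' : (unexplored m w k s A).Finite := (box_finite 0 m (-k - s) k).subset fun _ h => h.1
  refine (leftCluster_localOn.determinedBy hD).mul_le_real_inter
    (reaches_localOn.determinedBy hD') (isUpperSet_blue reaches_monotone) ?_
  intro ω hω hF
  have hω : leftCluster w k t (blue π ω) = A := hω
  obtain ⟨z, hz, hzk, q, hzq, r, hr, hqr⟩ := hF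
  refine ⟨z, hz, hzk, q, hzq, r, hr, hqr.mono ?_⟩
  rintro c ⟨hc, hcQ⟩
  refine ⟨?_, hcQ⟩
  unfold blue at hc ⊢
  rcases hi : π c with i | b
  · simp only [Set.mem_ofPred_eq, hi, Sum.elim_inl] at hc ⊢
    split_ifs at hc with hJ
    · obtain ⟨a, ⟨haN, hak⟩, hai⟩ := mem_sources.mp hJ
      rcases haN with ha | ha
      · rcases hπ a c i hai hi with rfl | hac
        · exact absurd (Or.inl ha) hcQ.2.1
        · exact absurd hac (not_adj4_unexplored hs hA hAw ha hcQ)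
      · rcases leftBoundary_leftCluster_subset (hω.symm ▸ ha) with h | h
        · have h1 : Sum.elim ω id (π a) = true := h.1
          simpa [hai] using h1
        · have h1 : a.2 = k + 1 := h.1
          have h2 := hak.2.2
          omega
    · exact hc
  · simpa only [Set.mem_ofPred_eq, hi, Sum.elim_inr] using hc

/-- With probability at least half the product of the probabilities of a horizontal crossing of
`[0, m] × [-k - s, k]` and of a vertical crossing of `[0, w] × [0, k]` ending in `[0, t] × {k}`, the
segment `[0, t] × {k}` is joined to the right side of `[0, m] × [-k - s, k]`. -/
theorem pr_mul_le_two_mul_pr_joins (hπ : Clustered π) (hsym : IsSymmetry π (rowReflection s))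
    (hs : s = 0 ∨ s = 1) (hk : 0 ≤ k) (hw : 0 ≤ w) (hwm : w < m) :
    pr p π (HCross 0 m (-k - s) k) *
        pr p π (Joins (box 0 w 0 k) {z | z.2 = 0} {z | z.2 = k ∧ z.1 ≤ t}) ≤
      2 * pr p π (Joins (box 0 m (-k - s) k) {z | z.2 = k ∧ z.1 ≤ t} {z | z.1 = m}) := by
  classical
  set T : Finset (Set (ℤ × ℤ)) :=
    (box_finite 0 w 0 (k + 1)).powerset.toFinset.filter fun A => ∀ a ∈ A, a.1 < w with hT
  have hTbox : ∀ A ∈ T, A ⊆ box 0 w 0 (k + 1) ∧ ∀ a ∈ A, a.1 < w := by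
    intro A hA
    simpa [hT] using hA
  have hV : pr p π (Joins (box 0 w 0 k) {z | z.2 = 0} {z | z.2 = k ∧ z.1 ≤ t}) ≤
      ∑ A ∈ T, pr p π fun b => leftCluster w k t b = A := by
    refine (pr_mono fun b hb => ?_).trans (pr_exists_le T fun A b => leftCluster w k t b = A)
    refine ⟨_, ?_, rfl⟩
    simpa [hT] using ⟨leftCluster_subset, fun x y h => leftCluster_lt hb _ h⟩
  have hsum : ∑ A ∈ T, pr p π (fun b => leftCluster w k t b = A ∧ Reaches m w k s A b) ≤
      pr p π (Joins (box 0 m (-k - s) k) {z | z.2 = k ∧ z.1 ≤ t} {z | z.1 = m}) := by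
    unfold pr
    rw [← measureReal_biUnion_finset]
    · refine measureReal_mono ?_
      intro ω hω
      simp only [Set.mem_iUnion] at hω
      obtain ⟨A, hA, h1, h2⟩ := hω
      exact h2.joins hs hk hw hwm h1 (hTbox A hA).2
    · intro A _ A' _ hAA'
      refine Set.disjoint_left.mpr ?_
      rintro ω ⟨h1, -⟩ ⟨h2, -⟩
      exact hAA' (h1.symm.trans h2)
    · intro A hA
      have h1 : LocalOn (box 0 (max w m) (-k - s) (k + 1))
          fun b => leftCluster w k t b = A ∧ Reaches m w k s A b := by
        intro b b' hb h
        refine ⟨(leftCluster_localOn.mono ?_) b b' hb h.1, (reaches_localOn.mono ?_) b b' hb h.2⟩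
        · rintro z ⟨-, hz⟩
          rw [mem_box] at *
          omega
        · rintro z ⟨hz, -⟩
          rw [mem_box] at *
          omega
      exact (h1.determinedBy (box_finite _ _ _ _)).measurableSet
  have hreach : ∀ A ∈ T, pr p π (HCross 0 m (-k - s) k) ≤ 2 * pr p π (Reaches m w k s A) := by
    intro A hA
    have h1 : pr p π (HCross 0 m (-k - s) k) ≤ _ :=
      (pr_mono fun b hb => hb.reaches hs hw hwm (hTbox A hA).1 (hTbox A hA).2).trans pr_or_le
    rw [hsym.pr_preimage (Φ := Reaches m w k s A)] at h1
    linarith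
  calc _ ≤ pr p π (HCross 0 m (-k - s) k) * ∑ A ∈ T, pr p π fun b => leftCluster w k t b = A :=
        mul_le_mul_of_nonneg_left hV pr_nonneg
    _ = ∑ A ∈ T, pr p π (HCross 0 m (-k - s) k) * pr p π fun b => leftCluster w k t b = A :=
        Finset.mul_sum _ _ _
    _ ≤ ∑ A ∈ T, 2 * pr p π fun b => leftCluster w k t b = A ∧ Reaches m w k s A b := by
        refine Finset.sum_le_sum fun A hA => ?_
        have h1 := pr_mul_le_pr_leftCluster_and_reaches (p := p) (t := t) (m := m) hπ hs
          (hTbox A hA).1 (hTbox A hA).2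
        have h2 := mul_le_mul_of_nonneg_right (hreach A hA)
          (pr_nonneg (p := p) (π := π) (Φ := fun b => leftCluster w k t b = A))
        linarith
    _ ≤ _ := by
        rw [← Finset.mul_sum]
        linarith

end Exploration

/-! ### Joining crossings -/

section Join

variable {x₀ x₁ y₀ y₁ : ℤ} {b : Set (ℤ × ℤ)}

lemma joined_row {B : Set (ℤ × ℤ)} {y : ℤ} (h : x₀ ≤ x₁)
    (hB : ∀ x, x₀ ≤ x → x ≤ x₁ → (x, y) ∈ B) : Joined Adj4 B (x₀, y) (x₁, y) := by
  induction x₁, h using Int.leInduction with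
  | base => exact .refl (hB _ le_rfl le_rfl)
  | succ n hn ih =>
    exact (ih fun x h1 h2 => hB x h1 (by omega)).tail (Or.inl ⟨rfl, Or.inr rfl⟩)
      (hB _ (by omega) le_rfl)

lemma joined_column {B : Set (ℤ × ℤ)} {x : ℤ} (h : y₀ ≤ y₁)
    (hB : ∀ y, y₀ ≤ y → y ≤ y₁ → (x, y) ∈ B) : Joined Adj4 B (x, y₀) (x, y₁) := by
  induction y₁, h using Int.leInduction with
  | base => exact .refl (hB _ le_rfl le_rfl)
  | succ n hn ih =>
    exact (ih fun x h1 h2 => hB x h1 (by omega)).tail (Or.inr ⟨rfl, Or.inr rfl⟩)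
      (hB _ (by omega) le_rfl)

lemma Joined.adj8 {B : Set (ℤ × ℤ)} {u v : ℤ × ℤ} (h : Joined Adj4 B u v) : Joined Adj8 B u v :=
  h.map id (fun _ h => h) fun _ hx _ hy hxy => .single hx hxy.adj8 hy

/-- Crossings of a rectangle contain crossings of narrower and higher rectangles. -/
lemma HCross.mono {x₀' x₁' y₀' y₁' : ℤ} (h : HCross x₀ x₁ y₀ y₁ b) (h0 : x₀ ≤ x₀')
    (h01 : x₀' ≤ x₁') (h1 : x₁' ≤ x₁) (h2 : y₀' ≤ y₀) (h3 : y₁ ≤ y₁') :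
    HCross x₀' x₁' y₀' y₁' b := by
  obtain ⟨u, hu, v, hv, huv⟩ := h
  have hu : u.1 = x₀ := hu
  have hv : v.1 = x₁ := hv
  obtain ⟨u', v', hu', hv', hj⟩ := huv.slab (fun _ _ => Adj4.symm) Prod.fst
    (fun a c h => by unfold Adj4 at h; omega) h01 (by omega) (by omega)
  refine ⟨u', hu', v', hv', hj.mono ?_⟩
  rintro z ⟨⟨hzb, hz⟩, hz'⟩
  simp only [Set.mem_ofPred_eq] at hz'
  refine ⟨hzb, ?_⟩
  rw [mem_box] at *
  omega

/-- A path from a point of the top side to the right side and a path from the left side to a point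
further right on the top side meet. -/
lemma hCross_of_joins_top {a c t : ℤ} (hx : x₀ ≤ a) (hc : c < x₁)
    (h : Joins (box a x₁ y₀ y₁) {z | z.2 = y₁ ∧ z.1 ≤ t} {z | z.1 = x₁} b)
    (h' : Joins (box x₀ c y₀ y₁) {z | z.2 = y₁ ∧ t ≤ z.1} {z | z.1 = x₀} b) :
    HCross x₀ x₁ y₀ y₁ b := by
  obtain ⟨u, ⟨hu, hut⟩, r, hr, hur⟩ := h
  obtain ⟨u', ⟨hu', hut'⟩, l, hl, hul⟩ := h'
  simp only [Set.mem_ofPred_eq] at hr hl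
  have hrR := hur.right_mem.2
  have huR := hur.left_mem.2
  have hu'R := hul.left_mem.2
  have hlR := hul.right_mem.2
  rw [mem_box] at hrR huR hu'R hlR
  have sub : ∀ a' c', x₀ ≤ a' → c' ≤ x₁ → b ∩ box a' c' y₀ y₁ ⊆ b ∩ box x₀ x₁ y₀ y₁ := by
    rintro a' c' ha hc q ⟨hq, hq'⟩
    refine ⟨hq, ?_⟩
    rw [mem_box] at *
    omega
  suffices h : ∃ z, Joined Adj4 (b ∩ box a x₁ y₀ y₁) u z ∧
      Joined Adj4 (b ∩ box x₀ c y₀ y₁) u' z by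
    obtain ⟨z, hz, hz'⟩ := h
    exact ⟨l, hl, r, hr, ((hul.symm4.trans hz').mono (sub _ _ le_rfl hc.le)).trans
      ((hz.symm4.trans hur).mono (sub _ _ hx le_rfl))⟩
  -- The first path is extended to the bottom row around the right side, the second one to the right
  -- along an additional row at the top; the extensions meet the paths only if `u = u'`.
  set G : Set (ℤ × ℤ) := {z | Joined Adj4 (b ∩ box a x₁ y₀ y₁) u z} ∪
    ({z | z.1 = x₁ + 1 ∧ y₀ ≤ z.2 ∧ z.2 ≤ r.2} ∪ {(u.1, y₁ + 1)}) with hG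
  set A : Set (ℤ × ℤ) := {z | Joined Adj4 (b ∩ box x₀ c y₀ y₁) u' z} ∪
    {z | z.2 = y₁ + 1 ∧ u'.1 ≤ z.1 ∧ z.1 ≤ x₁ + 1} with hA
  have hGj : Joined Adj4 G (x₁ + 1, y₀) (u.1, y₁ + 1) := by
    have h1 : Joined Adj4 G (x₁ + 1, y₀) (x₁ + 1, r.2) :=
      joined_column hrR.2.1 fun y hy hy' => Or.inr (Or.inl ⟨rfl, hy, hy'⟩)
    have h2 : Joined Adj4 G r u := (hur.cluster.mono Set.subset_union_left).symm4
    exact ((h1.tail (w := r) (by unfold Adj4; simp only [true_and]; omega) h2.left_mem).trans h2).tail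
      (w := (u.1, y₁ + 1)) (by unfold Adj4; simp only [true_and]; omega) (Or.inr (Or.inr rfl))
  have hAj : Joined Adj4 A l (x₁ + 1, y₁ + 1) := by
    have h1 : Joined Adj4 A (u'.1, y₁ + 1) (x₁ + 1, y₁ + 1) :=
      joined_row (by omega) fun x h h' => Or.inr ⟨rfl, h, h'⟩
    have h2 : Joined Adj4 A l u' := (hul.cluster.mono Set.subset_union_left).symm4
    exact (h2.tail (w := (u'.1, y₁ + 1)) (by unfold Adj4; simp only [true_and]; omega)
      h1.left_mem).trans h1
  obtain ⟨z, hzG, hzA⟩ := hGj.meet hAj.adj8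
    (by
      rintro z (hz | hz)
      · have := hz.right_mem.2.2; simp only; omega
      · have := hz.1; simp only; omega)
    (by
      rintro z (hz | hz | rfl)
      · have := hz.right_mem.2.1; simp only; omega
      · have := hz.1; simp only; omega
      · simp only; omega)
  rcases hzA with hzA | ⟨hz1, hz2, hz3⟩
  · rcases hzG with hzG | hzG | rfl
    · exact ⟨z, hzG, hzA⟩
    · have h1 := hzG.1; have h2 := hzA.right_mem.2.1; omega
    · have := hzA.right_mem.2.2; simp only at this; omega
  · rcases hzG with hzG | hzG | rfl
    · have := hzG.right_mem.2.2; omega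
    · have := hzG.2.2; omega
    · have : u = u' := Prod.ext (by simp only at hz2; omega) (by omega)
      exact ⟨u, .refl hur.left_mem, by rw [this]; exact .refl hul.left_mem⟩

end Join

/-! ### Bounds on crossing probabilities, and the Russo–Seymour–Welsh inequality -/

/-- All horizontal crossings of rectangles `[x, x + m] × [y, y + n]` have probability at least
`δ`. -/
def HorBound (p : I) (π : ℤ × ℤ → (ℤ × ℤ) ⊕ Bool) (δ : ℝ) (m n : ℤ) : Prop :=
  ∀ x y, δ ≤ pr p π (HCross x (x + m) y (y + n))

/-- All vertical crossings of rectangles `[x, x + m] × [y, y + n]` have probability at least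
`δ`. -/
def VerBound (p : I) (π : ℤ × ℤ → (ℤ × ℤ) ⊕ Bool) (δ : ℝ) (m n : ℤ) : Prop :=
  ∀ x y, δ ≤ pr p π (VCross x (x + m) y (y + n))

section Bounds

variable {p : I} {π : ℤ × ℤ → (ℤ × ℤ) ⊕ Bool} {δ η : ℝ} {m n w d k s : ℤ}

lemma HorBound.mono {m' n' : ℤ} (h : HorBound p π δ m n) (hm' : 0 ≤ m') (hm : m' ≤ m)
    (hn : n ≤ n') : HorBound p π δ m' n' := fun x y =>
  (h x y).trans (pr_mono fun _ hb => hb.mono le_rfl (by omega) (by omega) le_rfl (by omega))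

/-- Shifting or reflecting the columns. -/
lemma HorBound.comp (h : HorBound p π δ m n) {g : ℤ × ℤ → ℤ × ℤ} {ε x₀ y₀ : ℤ}
    (hε : ε = 1 ∨ ε = -1) (hg : ∀ z, g z = (x₀ + ε * z.1, y₀ + z.2)) :
    HorBound p (π ∘ g) δ m n := by
  intro x y
  rcases hε with rfl | rfl
  · refine (h (x₀ + x) (y₀ + y)).trans (pr_mono (π := π) (Ψ := fun b =>
      HCross x (x + m) y (y + n) (g ⁻¹' b)) fun b hb => ?_)
    refine Joins.map (fun z => (z.1 - x₀, z.2 - y₀)) hb ?_ ?_ ?_ ?_ ?_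
    · intro u v; unfold Adj4; simp only; omega
    · intro z hz; simpa [hg] using hz
    · intro z hz; rw [mem_box] at *; simp only; omega
    · intro z _ hz; simp only [Set.mem_ofPred_eq] at *; omega
    · intro z _ hz; simp only [Set.mem_ofPred_eq] at *; omega
  · refine (h (x₀ - (x + m)) (y₀ + y)).trans (pr_mono (π := π) (Ψ := fun b =>
      HCross x (x + m) y (y + n) (g ⁻¹' b)) fun b hb => ?_)
    refine Joins.map (fun z => (x₀ - z.1, z.2 - y₀)) hb.symm ?_ ?_ ?_ ?_ ?_
    · intro u v; unfold Adj4; simp only; omega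
    · intro z hz; simpa [hg] using hz
    · intro z hz; rw [mem_box] at *; simp only; omega
    · intro z _ hz; simp only [Set.mem_ofPred_eq] at *; omega
    · intro z _ hz; simp only [Set.mem_ofPred_eq] at *; omega

lemma VerBound.shift (h : VerBound p π δ m n) (x₀ y₀ : ℤ) :
    VerBound p (π ∘ fun z => (x₀ + z.1, y₀ + z.2)) δ m n := by
  intro x y
  refine (h (x₀ + x) (y₀ + y)).trans (pr_mono (π := π) (Ψ := fun b =>
    VCross x (x + m) y (y + n) ((fun z => (x₀ + z.1, y₀ + z.2)) ⁻¹' b)) fun b hb => ?_)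
  refine Joins.map (fun z => (z.1 - x₀, z.2 - y₀)) hb ?_ ?_ ?_ ?_ ?_
  · intro u v; unfold Adj4; simp only; omega
  · intro z hz; simpa using hz
  · intro z hz; rw [mem_box] at *; simp only; omega
  · intro z _ hz; simp only [Set.mem_ofPred_eq] at *; omega
  · intro z _ hz; simp only [Set.mem_ofPred_eq] at *; omega

lemma Clustered.comp (hπ : Clustered π) {g : ℤ × ℤ → ℤ × ℤ} {ε x₀ y₀ : ℤ}
    (hε : ε = 1 ∨ ε = -1) (hg : ∀ z, g z = (x₀ + ε * z.1, y₀ + z.2)) : Clustered (π ∘ g) := by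
  intro z z' i h h'
  have := hπ _ _ i h h'
  rw [hg, hg] at this
  unfold Adj4 at *
  rw [Prod.ext_iff] at *
  rcases hε with rfl | rfl
  · simp only at this; omega
  · simp only at this; omega

/-- A vertical crossing ends in the left part `[0, t]` or in the right part `[t, w]` of the top
side; for a suitable `t` both cases have at least half the probability. -/
lemma exists_split (hη : 0 ≤ η) (h : η ≤ pr p π (VCross 0 w 0 k)) :
    ∃ t : ℤ, η / 2 ≤ pr p π (Joins (box 0 w 0 k) {z | z.2 = 0} {z | z.2 = k ∧ z.1 ≤ t}) ∧
      η / 2 ≤ pr p π (Joins (box 0 w 0 k) {z | z.2 = 0} {z | z.2 = k ∧ t ≤ z.1}) := by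
  classical
  have hex : ∃ t : ℕ, η / 2 ≤
      pr p π (Joins (box 0 w 0 k) {z | z.2 = 0} {z | z.2 = k ∧ z.1 ≤ (t : ℤ)}) := by
    refine ⟨w.toNat, (by linarith : η / 2 ≤ η).trans (h.trans (pr_mono ?_))⟩
    rintro b ⟨u, hu, v, hv, huv⟩
    exact ⟨u, hu, v, ⟨hv, by have := huv.right_mem.2.1; omega⟩, huv⟩
  refine ⟨Nat.find hex, Nat.find_spec hex, ?_⟩
  rcases Nat.eq_zero_or_pos (Nat.find hex) with h0 | h0
  · rw [h0]
    refine (by linarith : η / 2 ≤ η).trans (h.trans (pr_mono ?_))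
    rintro b ⟨u, hu, v, hv, huv⟩
    exact ⟨u, hu, v, ⟨hv, huv.right_mem.2.1.1⟩, huv⟩
  · have h1 := Nat.find_min hex (Nat.sub_lt h0 one_pos)
    have h2 : pr p π (VCross 0 w 0 k) ≤
        pr p π (Joins (box 0 w 0 k) {z | z.2 = 0} {z | z.2 = k ∧ z.1 ≤ ((Nat.find hex - 1 : ℕ) : ℤ)})
        + pr p π (Joins (box 0 w 0 k) {z | z.2 = 0} {z | z.2 = k ∧ (Nat.find hex : ℤ) ≤ z.1}) := by
      refine (pr_mono ?_).trans pr_or_le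
      rintro b ⟨u, hu, v, hv, huv⟩
      by_cases hvt : v.1 ≤ ((Nat.find hex - 1 : ℕ) : ℤ)
      · exact Or.inl ⟨u, hu, v, ⟨hv, hvt⟩, huv⟩
      · exact Or.inr ⟨u, hu, v, ⟨hv, by omega⟩, huv⟩
    linarith

/-- Shifting or reflecting the columns does not affect the symmetry under reflection of the rows. -/
lemma isSymmetry_rowReflection_comp {g : ℤ × ℤ → ℤ × ℤ} {ε x₀ y₀ : ℤ}
    (hsym : IsSymmetry (π ∘ fun z => (z.1, y₀ + z.2)) (rowReflection s))
    (hg : ∀ z, g z = (x₀ + ε * z.1, y₀ + z.2)) : IsSymmetry (π ∘ g) (rowReflection s) := by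
  obtain ⟨e, he⟩ := hsym
  refine ⟨e, fun z => ?_⟩
  have := he (x₀ + ε * z.1, z.2)
  simp only [Function.comp_apply, rowReflection, hg] at this ⊢
  exact this

lemma HorBound.joins_top (hπ : Clustered π) (hs : s = 0 ∨ s = 1)
    (hsym : IsSymmetry π (rowReflection s)) (hη : 0 ≤ η) (hw : 0 ≤ w) (hd : 0 < d) (hk : 0 ≤ k)
    (h : HorBound p π δ (w + d) (2 * k + s)) {t : ℤ}
    (hV : η / 2 ≤ pr p π (Joins (box 0 w 0 k) {z | z.2 = 0} {z | z.2 = k ∧ z.1 ≤ t})) :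
    δ * η / 4 ≤
      pr p π (Joins (box 0 (w + d) (-k - s) k) {z | z.2 = k ∧ z.1 ≤ t} {z | z.1 = w + d}) := by
  have h1 := h 0 (-k - s)
  rw [zero_add, show -k - s + (2 * k + s) = k by ring] at h1
  have h2 := pr_mul_le_two_mul_pr_joins (p := p) (t := t) (m := w + d) hπ hsym hs hk hw (by omega)
  have h3 := mul_le_mul h1 hV (by positivity) pr_nonneg
  linarith

/-- The Russo–Seymour–Welsh inequality. A vertical crossing of the middle part, of width `w`, of
the upper half of the long rectangle ends left or right of a certain cell of the top side, chosen
so that both possibilities are about equally likely. If the part of the top side left of this cell is joined to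
the right side of the long rectangle, and the part right of it is joined to the left side, then
these two paths meet. -/
theorem HorBound.lengthen (hπ : Clustered π) (hs : s = 0 ∨ s = 1)
    (hsym : ∀ y₀, IsSymmetry (π ∘ fun z => (z.1, y₀ + z.2)) (rowReflection s))
    (hδ : 0 ≤ δ) (hη : 0 ≤ η) (hw : 0 ≤ w) (hd : 0 < d) (hk : 0 ≤ k)
    (h : HorBound p π δ (w + d) (2 * k + s)) (hV : VerBound p π η w k) :
    HorBound p π ((δ * η / 4) ^ 2) (w + 2 * d) (2 * k + s) := by
  intro x y
  set g : ℤ × ℤ → ℤ × ℤ := fun z => (x + d + z.1, y + k + s + z.2) with hg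
  set g' : ℤ × ℤ → ℤ × ℤ := fun z => (x + d + w - z.1, y + k + s + z.2) with hg'
  have eg : ∀ z, g z = (x + d + 1 * z.1, y + k + s + z.2) := fun z => by rw [one_mul]
  have eg' : ∀ z, g' z = (x + d + w + (-1) * z.1, y + k + s + z.2) := fun z => by
    simp only [hg']; congr 1; ring
  have hV0 := hV.shift (x + d) (y + k + s) 0 0
  rw [zero_add, zero_add] at hV0
  obtain ⟨t, ht, ht'⟩ := exists_split (π := π ∘ g) hη hV0
  have h1 := (h.comp (Or.inl rfl) eg).joins_top (hπ.comp (Or.inl rfl) eg) hs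
    (isSymmetry_rowReflection_comp (hsym _) eg) hη hw hd hk ht
  have h2 := (h.comp (Or.inr rfl) eg').joins_top (t := w - t) (hπ.comp (Or.inr rfl) eg') hs
    (isSymmetry_rowReflection_comp (hsym _) eg') hη hw hd hk <| by
      refine ht'.trans (pr_mono (π := π) (Φ := fun b => Joins _ _ _ (g ⁻¹' b))
        (Ψ := fun b => Joins _ _ _ (g' ⁻¹' b)) fun b hb => ?_)
      refine Joins.map (fun z => (w - z.1, z.2)) hb ?_ ?_ ?_ ?_ ?_
      · intro u v; unfold Adj4; simp only; omega
      · intro z hz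
        have : g' (w - z.1, z.2) = g z := by simp only [hg, hg']; congr 1; ring
        simpa only [Set.mem_preimage, this] using hz
      · intro z hz; rw [mem_box] at *; simp only; omega
      · intro z _ hz; exact hz
      · rintro z _ ⟨hz, hz'⟩; exact ⟨hz, by simp only; omega⟩
  have h3 : δ * η / 4 ≤ pr p (π ∘ g)
      (Joins (box (-d) w (-k - s) k) {z | z.2 = k ∧ t ≤ z.1} {z | z.1 = -d}) := by
    refine h2.trans (pr_mono (π := π) (Φ := fun b => Joins _ _ _ (g' ⁻¹' b))
        (Ψ := fun b => Joins _ _ _ (g ⁻¹' b)) fun b hb => ?_)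
    refine Joins.map (fun z => (w - z.1, z.2)) hb ?_ ?_ ?_ ?_ ?_
    · intro u v; unfold Adj4; simp only; omega
    · intro z hz
      have : g (w - z.1, z.2) = g' z := by simp only [hg, hg']; congr 1; ring
      simpa only [Set.mem_preimage, this] using hz
    · intro z hz; rw [mem_box] at *; simp only; omega
    · rintro z _ ⟨hz, hz'⟩; exact ⟨hz, by simp only; omega⟩
    · intro z _ hz; simp only [Set.mem_ofPred_eq] at *; omega
  have h4 := pr_mul_le_and (p := p) (π := π ∘ g) (box_finite _ _ _ _) (box_finite _ _ _ _)
    (joins_localOn : LocalOn _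
      (Joins (box 0 (w + d) (-k - s) k) {z | z.2 = k ∧ z.1 ≤ t} {z | z.1 = w + d}))
    (joins_localOn : LocalOn _
      (Joins (box (-d) w (-k - s) k) {z | z.2 = k ∧ t ≤ z.1} {z | z.1 = -d}))
    joins_monotone joins_monotone
  calc (δ * η / 4) ^ 2 = δ * η / 4 * (δ * η / 4) := sq _
    _ ≤ _ := mul_le_mul h1 h3 (by positivity) pr_nonneg
    _ ≤ _ := h4
    _ ≤ pr p π (HCross x (x + (w + 2 * d)) y (y + (2 * k + s))) := by
      refine pr_mono (π := π) (Φ := fun b => Joins _ _ _ (g ⁻¹' b) ∧ Joins _ _ _ (g ⁻¹' b))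
        fun b hb => ?_
      refine Joins.map g (hCross_of_joins_top (by omega) (by omega) hb.1 hb.2) ?_ ?_ ?_ ?_ ?_
      · intro u v; unfold Adj4; simp only [hg]; omega
      · intro z hz; exact hz
      · intro z hz; rw [mem_box] at *; simp only [hg]; omega
      · intro z _ hz; simp only [Set.mem_ofPred_eq, hg] at *; omega
      · intro z _ hz; simp only [Set.mem_ofPred_eq, hg] at *; omega

/-- The constant which is left of `δ` after `i` steps in the proof of `HorBound.lengthen_iterate`. -/
noncomputable def lengthenConst (δ η : ℝ) (i : ℕ) : ℝ := (fun δ => (δ * η / 4) ^ 2)^[i] δ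

lemma lengthenConst_pos (hδ : 0 < δ) (hη : 0 < η) (i : ℕ) : 0 < lengthenConst δ η i := by
  unfold lengthenConst
  induction i with
  | zero => exact hδ
  | succ i ih => rw [Function.iterate_succ_apply']; positivity

lemma HorBound.lengthen_iterate (hπ : Clustered π) (hs : s = 0 ∨ s = 1)
    (hsym : ∀ y₀, IsSymmetry (π ∘ fun z => (z.1, y₀ + z.2)) (rowReflection s))
    (hδ : 0 < δ) (hη : 0 < η) (hw : 0 ≤ w) (hd : 0 < d) (hk : 0 ≤ k)
    (h : HorBound p π δ (w + d) (2 * k + s)) (hV : VerBound p π η w k) (i : ℕ) :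
    HorBound p π (lengthenConst δ η i) (w + 2 ^ i * d) (2 * k + s) := by
  induction i with
  | zero => simpa [lengthenConst] using h
  | succ i ih =>
    have := ih.lengthen hπ hs hsym (lengthenConst_pos hδ hη i).le hη.le hw (by positivity) hk hV
    unfold lengthenConst at *
    rwa [Function.iterate_succ_apply', show w + 2 ^ (i + 1) * d = w + 2 * (2 ^ i * d) by ring]

end Bounds

section Models

variable {p : I} {π : ℤ × ℤ → (ℤ × ℤ) ⊕ Bool} {δ : ℝ} {m n : ℤ}

/-! ### Translations, transposition, and single cells -/

lemma HCross.swap {x₀ x₁ y₀ y₁ : ℤ} {b : Set (ℤ × ℤ)} (h : HCross x₀ x₁ y₀ y₁ b) :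
    VCross y₀ y₁ x₀ x₁ (Prod.swap ⁻¹' b) := by
  refine Joins.map Prod.swap h ?_ ?_ ?_ ?_ ?_
  · intro u v; simp only [Adj4, Prod.fst_swap, Prod.snd_swap]; omega
  · intro z hz; simpa using hz
  · intro z hz; exact ⟨hz.2, hz.1⟩
  · intro z _ hz; exact hz
  · intro z _ hz; exact hz

lemma VCross.swap {x₀ x₁ y₀ y₁ : ℤ} {b : Set (ℤ × ℤ)} (h : VCross x₀ x₁ y₀ y₁ b) :
    HCross y₀ y₁ x₀ x₁ (Prod.swap ⁻¹' b) := by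
  refine Joins.map Prod.swap h ?_ ?_ ?_ ?_ ?_
  · intro u v; simp only [Adj4, Prod.fst_swap, Prod.snd_swap]; omega
  · intro z hz; simpa using hz
  · intro z hz; exact ⟨hz.2, hz.1⟩
  · intro z _ hz; exact hz
  · intro z _ hz; exact hz

lemma HorBound.swap (h : HorBound p π δ m n) : VerBound p (π ∘ Prod.swap) δ n m := fun x y =>
  (h y x).trans (pr_mono (π := π) (Ψ := fun b => VCross _ _ _ _ (Prod.swap ⁻¹' b))
    fun _ hb => hb.swap)

lemma VerBound.swap (h : VerBound p π δ m n) : HorBound p (π ∘ Prod.swap) δ n m := fun x y =>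
  (h y x).trans (pr_mono (π := π) (Ψ := fun b => HCross _ _ _ _ (Prod.swap ⁻¹' b))
    fun _ hb => hb.swap)

lemma VerBound.mono {m' n' : ℤ} (h : VerBound p π δ m n) (hm : m ≤ m') (hn' : 0 ≤ n')
    (hn : n' ≤ n) : VerBound p π δ m' n' :=
  (h.swap.mono hn' hn hm).swap

lemma IsSymmetry.pr_hCross_le {dx dy x₀ x₁ y₀ y₁ : ℤ}
    (h : IsSymmetry π fun z => (dx + z.1, dy + z.2)) :
    pr p π (HCross x₀ x₁ y₀ y₁) ≤ pr p π (HCross (dx + x₀) (dx + x₁) (dy + y₀) (dy + y₁)) := by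
  rw [← h.pr_preimage]
  refine pr_mono fun b hb => ?_
  refine Joins.map (fun z => (dx + z.1, dy + z.2)) hb ?_ ?_ ?_ ?_ ?_
  · intro u v; unfold Adj4; simp only; omega
  · intro z hz; exact hz
  · intro z hz; rw [mem_box] at *; simp only; omega
  · intro z _ hz; simp only [Set.mem_ofPred_eq] at *; omega
  · intro z _ hz; simp only [Set.mem_ofPred_eq] at *; omega

lemma IsSymmetry.pr_vCross_le {dx dy x₀ x₁ y₀ y₁ : ℤ}
    (h : IsSymmetry π fun z => (dx + z.1, dy + z.2)) :
    pr p π (VCross x₀ x₁ y₀ y₁) ≤ pr p π (VCross (dx + x₀) (dx + x₁) (dy + y₀) (dy + y₁)) := by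
  rw [← h.pr_preimage]
  refine pr_mono fun b hb => ?_
  refine Joins.map (fun z => (dx + z.1, dy + z.2)) hb ?_ ?_ ?_ ?_ ?_
  · intro u v; unfold Adj4; simp only; omega
  · intro z hz; exact hz
  · intro z hz; rw [mem_box] at *; simp only; omega
  · intro z _ hz; simp only [Set.mem_ofPred_eq] at *; omega
  · intro z _ hz; simp only [Set.mem_ofPred_eq] at *; omega

lemma productLaw_real_true {ι : Type} (i : ι) : (productLaw ι p).real {ω | ω i = true} = p := by
  have h := Measure.infinitePi_map_eval (fun _ : ι => bernoulliMeasure true false p) i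
  rw [show {ω : ι → Bool | ω i = true} = (fun ω => ω i) ⁻¹' {true} from rfl,
    ← map_measureReal_apply (measurable_pi_apply i) MeasurableSet.of_discrete]
  change ((productLaw ι p).map (Function.eval i)).real {true} = p
  unfold productLaw
  rw [h]
  simp

lemma pr_mem_eq {z i : ℤ × ℤ} (h : π z = Sum.inl i) : pr p π (fun b => z ∈ b) = p := by
  rw [← productLaw_real_true (p := p) i]
  unfold pr blue
  simp [h]

lemma pow_le_pr_hCross (h : ∀ x, (p : ℝ) ≤ pr p π (fun b => (x, 0) ∈ b)) (m : ℕ) :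
    (p : ℝ) ^ (m + 1) ≤ pr p π (HCross 0 m 0 0) := by
  induction m with
  | zero =>
    rw [zero_add, pow_one]
    refine (h 0).trans (pr_mono fun b hb => ?_)
    exact ⟨(0, 0), rfl, (0, 0), rfl, .refl ⟨hb, by simp [mem_box]⟩⟩
  | succ m ih =>
    have h1 : LocalOn {((m : ℤ) + 1, 0)} fun b => ((m : ℤ) + 1, (0 : ℤ)) ∈ b := by
      intro b b' hb hm
      have : ((m : ℤ) + 1, (0 : ℤ)) ∈ b' ∩ {((m : ℤ) + 1, 0)} := hb ▸ ⟨hm, rfl⟩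
      exact this.1
    have h2 := pr_mul_le_and (p := p) (π := π) (box_finite _ _ _ _) (Set.finite_singleton _)
      (joins_localOn : LocalOn _ (HCross 0 m 0 0)) h1 joins_monotone
      (fun _ _ hb hm => hb hm)
    rw [pow_succ]
    refine (mul_le_mul ih (h _) p.2.1 pr_nonneg).trans (h2.trans (pr_mono ?_))
    rintro b ⟨⟨u, hu, v, hv, huv⟩, hb⟩
    have hv : v.1 = m := hv
    have hv' := huv.right_mem.2.2
    refine ⟨u, hu, ((m : ℤ) + 1, 0), by simp, ((huv.mono ?_).tail ?_ ?_)⟩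
    · rintro z ⟨hz, hz'⟩
      refine ⟨hz, ?_⟩
      rw [mem_box] at *
      push_cast
      omega
    · unfold Adj4; simp only; omega
    · refine ⟨hb, ?_⟩
      rw [mem_box]
      simp only [Nat.cast_add, Nat.cast_one]
      omega

end Models

/-! ### Walks in lattices -/

lemma exists_walk_iff_joined (G : SimpleGraph (ℤ × ℤ)) (Q : Sym2 (ℤ × ℤ) → Prop)
    {S : Set (ℤ × ℤ)} {x y : ℤ × ℤ} :
    (∃ w : G.Walk x y, (∀ v ∈ w.support, v ∈ S) ∧ ∀ e ∈ w.edges, Q e) ↔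
      Joined (fun x y => G.Adj x y ∧ Q s(x, y)) S x y := by
  constructor
  · rintro ⟨w, hw, hQ⟩
    induction w with
    | nil => exact .refl (hw _ (by simp))
    | cons h w ih =>
      simp only [SimpleGraph.Walk.support_cons, List.mem_cons, forall_eq_or_imp,
        SimpleGraph.Walk.edges_cons] at hw hQ
      exact (Joined.single hw.1 ⟨h, hQ.1⟩ (hw.2 _ w.start_mem_support)).trans (ih hw.2 hQ.2)
  · intro h
    refine h.rec_tail (P := fun y => ∃ w : G.Walk x y, (∀ v ∈ w.support, v ∈ S) ∧
      ∀ e ∈ w.edges, Q e) ⟨.nil, by simpa using h.left_mem, by simp⟩ ?_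
    · rintro a y - ⟨w, hw, hQ⟩ h hy
      refine ⟨w.concat h.1, ?_, ?_⟩
      · intro v hv
        rw [SimpleGraph.Walk.support_concat] at hv
        simp only [List.mem_append, List.mem_singleton] at hv
        rcases hv with hv | rfl
        exacts [hw v hv, hy]
      · intro e he
        rw [SimpleGraph.Walk.edges_concat] at he
        simp only [List.concat_eq_append, List.mem_append, List.mem_singleton] at he
        rcases he with he | rfl
        exacts [hQ e he, h.2]

/-! ### Bond percolation on the square lattice -/

/-- The colouring of cells for bond percolation on the square lattice. The cell `2 x` belongs to
the vertex `x` and is always blue, the cell `x + y` belongs to the edge `{x, y}`, and the remaining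
cells, which belong to the faces, are always yellow. -/
def squareCell (z : ℤ × ℤ) : (ℤ × ℤ) ⊕ Bool :=
  if z.1 % 2 = 0 ∧ z.2 % 2 = 0 then .inr true
  else if z.1 % 2 = 1 ∧ z.2 % 2 = 1 then .inr false else .inl z

lemma mem_blue_squareCell {ω : ℤ × ℤ → Bool} {z : ℤ × ℤ} :
    z ∈ blue squareCell ω ↔ (z.1 % 2 = 0 ∧ z.2 % 2 = 0) ∨
      (¬(z.1 % 2 = 1 ∧ z.2 % 2 = 1) ∧ ω z = true) := by
  unfold blue squareCell
  simp only [Set.mem_ofPred_eq]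
  split_ifs with h h'
  · simp only [Sum.elim_inr, id]; tauto
  · simp only [Sum.elim_inr, id, Bool.false_eq_true, false_iff]; tauto
  · simp only [Sum.elim_inl]; tauto

lemma clustered_squareCell : Clustered squareCell := by
  intro z z' i h h'
  unfold squareCell at h h'
  split_ifs at h h'
  simp only [Sum.inl.injEq] at h h'
  exact Or.inl (h.trans h'.symm)

lemma isSymmetry_squareCell_rowReflection (y₀ : ℤ) :
    IsSymmetry (squareCell ∘ fun z => (z.1, y₀ + z.2)) (rowReflection 0) := by
  refine ⟨⟨fun z => (z.1, 2 * y₀ - z.2), fun z => (z.1, 2 * y₀ - z.2), fun z => by simp,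
    fun z => by simp⟩, fun z => ?_⟩
  simp only [Function.comp_apply, squareCell, rowReflection]
  have : (y₀ + (-0 - z.2)) % 2 = (y₀ + z.2) % 2 := by omega
  rw [this]
  split_ifs
  · rfl
  · rfl
  · simp only [Sum.map_inl, Equiv.coe_fn_mk, Sum.inl.injEq, Prod.mk.injEq, true_and]
    omega

lemma isSymmetry_squareCell_swap : IsSymmetry squareCell Prod.swap := by
  refine ⟨Equiv.prodComm _ _, fun z => ?_⟩
  simp only [squareCell, Prod.fst_swap, Prod.snd_swap, and_comm (a := z.2 % 2 = 0),
    and_comm (a := z.2 % 2 = 1)]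
  split_ifs <;> rfl

lemma isSymmetry_squareCell_shift (a c : ℤ) :
    IsSymmetry squareCell fun z => (2 * a + z.1, 2 * c + z.2) := by
  refine ⟨Equiv.addLeft (2 * a, 2 * c), fun z => ?_⟩
  have h1 : (2 * a + z.1) % 2 = z.1 % 2 := by omega
  have h2 : (2 * c + z.2) % 2 = z.2 % 2 := by omega
  simp only [squareCell, h1, h2]
  split_ifs <;> rfl

/-- The cell of an edge: its midpoint, after doubling the coordinates. -/
def edgeCell (e : squareLattice.edgeSet) : ℤ × ℤ :=
  Sym2.lift ⟨fun u v => u + v, add_comm⟩ e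

lemma squareLattice_adj {x y : ℤ × ℤ} : squareLattice.Adj x y ↔ Adj4 x y := by
  simp only [squareLattice, Adj4, Set.mem_insert_iff, Set.mem_singleton_iff, Prod.ext_iff,
    Prod.fst_sub, Prod.snd_sub]
  omega

lemma edgeCell_injective : Function.Injective edgeCell := by
  rintro ⟨e, he⟩ ⟨e', he'⟩ h
  induction e using Sym2.ind with | _ u v => ?_
  induction e' using Sym2.ind with | _ u' v' => ?_
  rw [SimpleGraph.mem_edgeSet, squareLattice_adj] at he he'
  simp only [edgeCell, Sym2.lift_mk, Prod.ext_iff, Prod.fst_add, Prod.snd_add] at h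
  simp only [Subtype.mk.injEq, Sym2.eq_iff, Prod.ext_iff]
  unfold Adj4 at he he'
  omega

/-- The restriction of a configuration of cells to the edges. -/
def edgeColour (ω : ℤ × ℤ → Bool) : squareLattice.edgeSet → Bool := ω ∘ edgeCell

lemma mem_bondCrossing_iff {m n : ℕ} {ω : squareLattice.edgeSet → Bool} :
    ω ∈ bondCrossing m n ↔ ∃ x y : ℤ × ℤ, x.1 = 0 ∧ y.1 = m ∧
      Joined (fun x y => squareLattice.Adj x y ∧ ∀ h : s(x, y) ∈ squareLattice.edgeSet,
        ω ⟨s(x, y), h⟩ = true) (rectangle m n) x y := by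
  unfold bondCrossing
  simp only [Set.mem_ofPred_eq]
  refine exists_congr fun x => exists_congr fun y => ?_
  rw [← exists_walk_iff_joined squareLattice
    (fun e => ∀ h : e ∈ squareLattice.edgeSet, ω ⟨e, h⟩ = true)]
  constructor
  · rintro ⟨w, h1, h2, h3, h4⟩
    exact ⟨h1, h2, w, h3, fun e he h => h4 ⟨e, h⟩ he⟩
  · rintro ⟨h1, h2, w, h3, h4⟩
    exact ⟨w, h1, h2, h3, fun e he => h4 e he e.2⟩

/-- A cell of a blue path is sent to the vertex at its lower left end; then each step of the path
of cells either keeps the vertex or passes a blue edge. -/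
lemma edgeColour_mem_bondCrossing {m n : ℕ} {ω : ℤ × ℤ → Bool} :
    edgeColour ω ∈ bondCrossing m n ↔ HCross 0 (2 * m) 0 (2 * n) (blue squareCell ω) := by
  rw [mem_bondCrossing_iff]
  constructor
  · rintro ⟨x, y, hx, hy, h⟩
    have hR : ∀ z ∈ rectangle m n,
        (2 * z.1, 2 * z.2) ∈ blue squareCell ω ∩ box 0 (2 * m) 0 (2 * n) := by
      rintro z ⟨hz, hz'⟩
      refine ⟨mem_blue_squareCell.mpr (Or.inl ⟨by simp, by simp⟩), ?_⟩
      rw [mem_box]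
      simp only
      omega
    refine ⟨(2 * x.1, 2 * x.2), by simp [hx], (2 * y.1, 2 * y.2), by simp [hy],
      h.map (fun z => (2 * z.1, 2 * z.2)) hR ?_⟩
    rintro u hu v hv ⟨ha, hω⟩
    have hb := hω ((SimpleGraph.mem_edgeSet _).mpr ha)
    have hb : ω (u + v) = true := hb
    rw [squareLattice_adj] at ha
    have hu' := hR u hu
    have hv' := hR v hv
    have hmid : u + v ∈ blue squareCell ω ∩ box 0 (2 * m) 0 (2 * n) := by
      refine ⟨mem_blue_squareCell.mpr (Or.inr ⟨?_, hb⟩), ?_⟩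
      · unfold Adj4 at ha
        simp only [Prod.fst_add, Prod.snd_add]
        omega
      · have h1 := hu'.2
        have h2 := hv'.2
        rw [mem_box] at *
        simp only [Prod.fst_add, Prod.snd_add] at *
        omega
    refine (Joined.single hu' ?_ hmid).tail ?_ hv'
    · unfold Adj4 at *
      simp only [Prod.fst_add, Prod.snd_add]
      omega
    · unfold Adj4 at *
      simp only [Prod.fst_add, Prod.snd_add]
      omega
  · rintro ⟨x, hx, y, hy, h⟩
    have hx : x.1 = 0 := hx
    have hy : y.1 = 2 * m := hy
    have hR : ∀ z ∈ blue squareCell ω ∩ box 0 (2 * m) 0 (2 * n),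
        (z.1 / 2, z.2 / 2) ∈ rectangle m n := by
      rintro z ⟨-, hz⟩
      rw [mem_box] at hz
      refine ⟨?_, ?_⟩ <;> simp only <;> omega
    refine ⟨(x.1 / 2, x.2 / 2), (y.1 / 2, y.2 / 2), by simp [hx], by simp [hy],
      h.map (fun z => (z.1 / 2, z.2 / 2)) hR ?_⟩
    rintro u hu v hv ha
    have hu' := hR u hu
    have hv' := hR v hv
    by_cases heq : (u.1 / 2, u.2 / 2) = (v.1 / 2, v.2 / 2)
    · simp only [heq]
      exact .refl hv'
    refine Joined.single hu' ?_ hv'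
    have hbu := mem_blue_squareCell.mp hu.1
    have hbv := mem_blue_squareCell.mp hv.1
    simp only [Prod.mk.injEq] at heq
    refine ⟨?_, fun h => ?_⟩
    · rw [squareLattice_adj]
      unfold Adj4 at *
      simp only
      omega
    · show ω ((u.1 / 2, u.2 / 2) + (v.1 / 2, v.2 / 2)) = true
      unfold Adj4 at ha
      by_cases hue : u.1 % 2 = 0 ∧ u.2 % 2 = 0
      · have : (u.1 / 2, u.2 / 2) + (v.1 / 2, v.2 / 2) = v := by
          ext <;> simp only [Prod.fst_add, Prod.snd_add] <;> omega
        rw [this]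
        refine (hbv.resolve_left ?_).2
        omega
      · have : (u.1 / 2, u.2 / 2) + (v.1 / 2, v.2 / 2) = u := by
          ext <;> simp only [Prod.fst_add, Prod.snd_add] <;> omega
        rw [this]
        exact (hbu.resolve_left hue).2

lemma bondCrossing_determinedBy (m n : ℕ) : ∃ J, DeterminedBy (bondCrossing m n) J := by
  refine ⟨((box_finite 0 (2 * m) 0 (2 * n)).preimage edgeCell_injective.injOn).toFinset, ?_⟩
  intro ω ω' h hω
  rw [mem_bondCrossing_iff] at *
  obtain ⟨x, y, hx, hy, hj⟩ := hω
  refine ⟨x, y, hx, hy, hj.map id (fun _ h => h) fun u hu v hv ⟨ha, hω⟩ => ?_⟩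
  refine .single hu ⟨ha, fun he => ?_⟩ hv
  rw [← h _ ?_]
  · exact hω he
  · simp only [Set.Finite.mem_toFinset, Set.mem_preimage, edgeCell, Sym2.lift_mk]
    obtain ⟨h1, h2⟩ := hu
    obtain ⟨h3, h4⟩ := hv
    rw [mem_box]
    simp only [Prod.fst_add, Prod.snd_add, id]
    omega

lemma crossingProb_squareBond (p : I) (m n : ℕ) :
    crossingProb .squareBond p m n = pr p squareCell (HCross 0 (2 * m) 0 (2 * n)) := by
  obtain ⟨J, hJ⟩ := bondCrossing_determinedBy m n
  have h : (productLaw (ℤ × ℤ) p).map edgeColour = productLaw squareLattice.edgeSet p :=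
    Measure.map_infinitePi_infinitePi_of_inj
      (P := fun _ : ℤ × ℤ => bernoulliMeasure true false p) edgeCell_injective
  have hm : Measurable edgeColour := measurable_pi_lambda _ fun e => measurable_pi_apply _
  simp only [crossingProb]
  rw [← h, map_measureReal_apply hm hJ.measurableSet]
  unfold pr
  congr 1
  ext ω
  exact edgeColour_mem_bondCrossing

variable {p : I} {δ : ℝ}

/-- The translations by an even number of rows and columns preserve the kinds of cells; the
crossing is therefore shortened by one column, and the rectangle made higher by one row. -/
lemma horBound_squareCell {j : ℕ} (hj : 1 ≤ j) (h : δ ≤ crossingProb .squareBond p j j) :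
    HorBound p squareCell δ (2 * j - 1) (2 * j + 1) := by
  intro x y
  rw [crossingProb_squareBond] at h
  exact h.trans (((isSymmetry_squareCell_shift (x / 2) ((y + 1) / 2)).pr_hCross_le).trans
    (pr_mono fun b hb => hb.mono (by omega) (by omega) (by omega) (by omega) (by omega)))

lemma IsSymmetry.verBound_of_swap {π : ℤ × ℤ → (ℤ × ℤ) ⊕ Bool} {m n : ℤ}
    (hsym : IsSymmetry π Prod.swap) (h : HorBound p π δ m n) : VerBound p π δ n m := by
  intro x y
  refine (h y x).trans ?_
  rw [← hsym.pr_preimage]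
  exact pr_mono fun b hb => hb.swap

/-- Crossings of larger squares in bond percolation: the inequality is applied to horizontal
crossings of rectangles of about `4 t × 4 t` cells, which come from the scale `2 t`, and vertical
crossings of rectangles of about `2 t × 2 t` cells, which come from the scale `t`. -/
lemma crossingProb_squareBond_ge (δ : ℝ) (hδ : 0 < δ) (K : ℕ) :
    ∃ c > 0, ∃ n₀ : ℕ, ∀ p : I, ∀ n : ℕ, n₀ ≤ n →
      (∀ j : ℕ, 1 ≤ j → j ≤ n → δ ≤ crossingProb .squareBond p j j) →
      ∀ N : ℕ, n < N → N ≤ K * (n + 1) → c ≤ crossingProb .squareBond p N N := by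
  obtain ⟨i, hi⟩ : ∃ i : ℕ, 8 * K ≤ 2 ^ i := ⟨8 * K, Nat.lt_two_pow_self.le⟩
  refine ⟨lengthenConst δ δ i, lengthenConst_pos hδ hδ i, 8, fun p n hn h N hnN hN => ?_⟩
  obtain ⟨t, ht⟩ : ∃ t : ℕ, t = n / 2 := ⟨_, rfl⟩
  have h1 := horBound_squareCell (by omega) (h (2 * t) (by omega) (by omega))
  have h2 := isSymmetry_squareCell_swap.verBound_of_swap
    (horBound_squareCell (by omega) (h (t + 1) (by omega) (by omega)))
  have h3 := HorBound.lengthen_iterate (d := 2 * t - 4) (w := 2 * t + 3) (k := 2 * t + 1) (s := 0)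
    clustered_squareCell (Or.inl rfl) isSymmetry_squareCell_rowReflection hδ hδ (by omega)
    (by omega) (by omega) (h1.mono (by omega) (by push_cast; omega) (by push_cast; omega))
    (h2.mono (by push_cast; omega) (by omega) (by push_cast; omega)) i
  rw [crossingProb_squareBond]
  refine (h3 0 0).trans (pr_mono fun b hb => hb.mono le_rfl (by omega) ?_ le_rfl (by omega))
  have h4 : 2 * N ≤ 2 ^ i * t := by
    calc 2 * N ≤ 2 * (K * (n + 1)) := by omega
      _ ≤ 2 * (K * (4 * t)) := by gcongr; omega
      _ = 8 * K * t := by ring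
      _ ≤ _ := by gcongr
  have h5 : (2 : ℤ) ^ i * t ≤ 2 ^ i * (2 * t - 4) := by
    gcongr
    omega
  have h6 : (2 * N : ℤ) ≤ 2 ^ i * t := by exact_mod_cast h4
  omega

lemma crossingProb_squareBond_one_le (p : I) : crossingProb .squareBond p 1 1 ≤ 2 * p := by
  rw [crossingProb_squareBond]
  have h1 : pr p squareCell (fun b => (1, 0) ∈ b) = p := pr_mem_eq (i := (1, 0)) rfl
  have h2 : pr p squareCell (fun b => (1, 2) ∈ b) = p := pr_mem_eq (i := (1, 2)) rfl
  calc _ ≤ pr p squareCell (fun b => (1, 0) ∈ b ∨ (1, 2) ∈ b) := ?_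
    _ ≤ p + p := pr_or_le.trans (by rw [h1, h2])
    _ = 2 * p := by ring
  refine measureReal_mono fun ω hω => ?_
  have hω : HCross 0 2 0 2 (blue squareCell ω) := hω
  obtain ⟨u, hu, v, hv, huv⟩ := hω.mono (x₀' := 1) (x₁' := 1) (by omega) (by omega) (by omega)
    le_rfl le_rfl
  have hu1 : u.1 = 1 := hu
  have h3 := huv.left_mem.2.2
  have h4 := mem_blue_squareCell.mp huv.left_mem.1
  -- the remaining cell `(1, 1)` belongs to a face and is yellow
  have h5 : u = (1, 0) ∨ u = (1, 2) := by
    simp only [Prod.ext_iff]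
    omega
  rcases h5 with h | h
  · exact Or.inl (h ▸ huv.left_mem.1)
  · exact Or.inr (h ▸ huv.left_mem.1)

lemma pow_le_crossingProb_squareBond (p : I) (N : ℕ) :
    (p : ℝ) ^ (2 * N + 1) ≤ crossingProb .squareBond p N N := by
  rw [crossingProb_squareBond]
  refine (pow_le_pr_hCross (π := squareCell) (fun x => ?_) (2 * N)).trans
    (pr_mono fun b hb => hb.mono le_rfl (by omega) (by push_cast; omega) le_rfl (by omega))
  by_cases hx : x % 2 = 0
  · refine p.2.2.trans (le_of_eq ?_)
    have : {ω : ℤ × ℤ → Bool | (x, 0) ∈ blue squareCell ω} = Set.univ := by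
      ext ω
      simp [mem_blue_squareCell, hx]
    unfold pr
    rw [this, probReal_univ]
  · refine (pr_mem_eq (i := (x, 0)) ?_).ge
    simp [squareCell, hx]

/-! ### Site percolation on the triangular lattice -/

section Triangular

variable {p : I} {δ : ℝ}

/-- The site of a cell, if the site `(a, b)` is drawn as the brick made up of the cells
`(2 a + b, b)` and `(2 a + b + 1, b)`. Two sites are neighbours if and only if their bricks share a
side of a cell. -/
def brick (z : ℤ × ℤ) : ℤ × ℤ := ((z.1 - z.2) / 2, z.2)

/-- The colouring of cells for site percolation on the triangular lattice. -/
def triCell (z : ℤ × ℤ) : (ℤ × ℤ) ⊕ Bool := .inl (brick z)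

lemma mem_blue_triCell {ω : ℤ × ℤ → Bool} {z : ℤ × ℤ} :
    z ∈ blue triCell ω ↔ ω (brick z) = true := Iff.rfl

lemma clustered_triCell : Clustered triCell := by
  intro z z' i h h'
  simp only [triCell, brick, Sum.inl.injEq, Prod.ext_iff] at h h'
  unfold Adj4
  rw [Prod.ext_iff]
  omega

lemma clustered_triCell_swap : Clustered (triCell ∘ Prod.swap) := by
  intro z z' i h h'
  simp only [Function.comp_apply, triCell, brick, Sum.inl.injEq, Prod.ext_iff, Prod.fst_swap,
    Prod.snd_swap] at h h'
  unfold Adj4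
  rw [Prod.ext_iff]
  omega

/-- Reflecting the rows about a row of bricks. -/
lemma isSymmetry_triCell_rowReflection (y₀ : ℤ) :
    IsSymmetry (triCell ∘ fun z => (z.1, y₀ + z.2)) (rowReflection 0) := by
  refine ⟨⟨fun a => (a.1 + a.2 - y₀, 2 * y₀ - a.2), fun a => (a.1 + a.2 - y₀, 2 * y₀ - a.2),
    fun a => ?_, fun a => ?_⟩, fun z => ?_⟩
  · simp only [Prod.ext_iff]; omega
  · simp only [Prod.ext_iff]; omega
  · simp only [Function.comp_apply, triCell, brick, rowReflection, Sum.map_inl, Equiv.coe_fn_mk,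
      Sum.inl.injEq, Prod.ext_iff]
    omega

/-- Reflecting the columns, which have been made the rows. The reflection of a brick is a brick only
if it exchanges two neighbouring columns. -/
lemma isSymmetry_triCell_swap_rowReflection (y₀ : ℤ) :
    IsSymmetry ((triCell ∘ Prod.swap) ∘ fun z => (z.1, y₀ + z.2)) (rowReflection 1) := by
  refine ⟨⟨fun a => (y₀ - a.2 - 1 - a.1, a.2), fun a => (y₀ - a.2 - 1 - a.1, a.2),
    fun a => ?_, fun a => ?_⟩, fun z => ?_⟩
  · simp only [Prod.ext_iff, and_true]; omega
  · simp only [Prod.ext_iff, and_true]; omega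
  · simp only [Function.comp_apply, triCell, brick, rowReflection, Sum.map_inl, Equiv.coe_fn_mk,
      Sum.inl.injEq, Prod.ext_iff, Prod.swap_prod_mk, and_true]
    omega

lemma isSymmetry_triCell_shift {dx dy : ℤ} (h : (dx - dy) % 2 = 0) :
    IsSymmetry triCell fun z => (dx + z.1, dy + z.2) := by
  refine ⟨Equiv.addLeft ((dx - dy) / 2, dy), fun z => ?_⟩
  simp only [triCell, brick, Sum.map_inl, Equiv.coe_addLeft, Sum.inl.injEq, Prod.ext_iff,
    Prod.fst_add, Prod.snd_add, and_true]
  omega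

/-- A translation sends bricks to bricks if the numbers of rows and columns have the same parity.
This costs one column. -/
lemma horBound_triCell {x₀ x₁ y₀ y₁ : ℤ} (hx : x₀ < x₁)
    (h : δ ≤ pr p triCell (HCross x₀ x₁ y₀ y₁)) :
    HorBound p triCell δ (x₁ - x₀ - 1) (y₁ - y₀) := by
  intro x y
  have hd : (x - x₀ - (x - x₀ - (y - y₀)) % 2 - (y - y₀)) % 2 = 0 := by omega
  exact h.trans ((isSymmetry_triCell_shift hd).pr_hCross_le.trans
    (pr_mono fun b hb => hb.mono (by omega) (by omega) (by omega) (by omega) (by omega)))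

lemma verBound_triCell {x₀ x₁ y₀ y₁ : ℤ}
    (h : δ ≤ pr p triCell (VCross x₀ x₁ y₀ y₁)) :
    VerBound p triCell δ (x₁ - x₀ + 1) (y₁ - y₀) := by
  intro x y
  have hd : (x - x₀ + (x - x₀ - (y - y₀)) % 2 - (y - y₀)) % 2 = 0 := by omega
  refine h.trans ((isSymmetry_triCell_shift hd).pr_vCross_le.trans (pr_mono fun b hb => ?_))
  refine Joins.map id hb (fun _ _ h => h) (fun _ h => h) ?_ ?_ ?_
  · intro z hz; rw [mem_box] at *; simp only [id]; omega
  · intro z _ hz; simp only [Set.mem_ofPred_eq, id] at *; omega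
  · intro z _ hz; simp only [Set.mem_ofPred_eq, id] at *; omega

lemma triangularLattice_adj {x y : ℤ × ℤ} : triangularLattice.Adj x y ↔
    ((y.2 = x.2 ∧ (y.1 = x.1 + 1 ∨ x.1 = y.1 + 1)) ∨ (y.1 = x.1 ∧ (y.2 = x.2 + 1 ∨ x.2 = y.2 + 1)) ∨
      (y.1 = x.1 + 1 ∧ x.2 = y.2 + 1) ∨ (x.1 = y.1 + 1 ∧ y.2 = x.2 + 1)) := by
  simp only [triangularLattice, Set.mem_insert_iff, Set.mem_singleton_iff, Prod.ext_iff,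
    Prod.fst_sub, Prod.snd_sub]
  omega

/-- The paths of blue sites in `D` correspond to the paths of blue cells in the union of the bricks
of `D`. -/
lemma exists_joined_sites_iff {ω : ℤ × ℤ → Bool} {D U V : Set (ℤ × ℤ)} :
    (∃ x ∈ U, ∃ y ∈ V, Joined triangularLattice.Adj ({v | ω v = true} ∩ D) x y) ↔
      Joins (brick ⁻¹' D) (brick ⁻¹' U) (brick ⁻¹' V) (blue triCell ω) := by
  have left : ∀ a : ℤ × ℤ, brick (2 * a.1 + a.2, a.2) = a := by
    intro a
    simp only [brick, Prod.ext_iff, and_true]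
    omega
  have right : ∀ a : ℤ × ℤ, brick (2 * a.1 + a.2 + 1, a.2) = a := by
    intro a
    simp only [brick, Prod.ext_iff, and_true]
    omega
  constructor
  · rintro ⟨x, hx, y, hy, h⟩
    refine ⟨(2 * x.1 + x.2, x.2), by simpa [left] using hx, (2 * y.1 + y.2, y.2),
      by simpa [left] using hy, h.map (fun a => (2 * a.1 + a.2, a.2)) (fun a ha => ?_) ?_⟩
    · exact ⟨by simpa [mem_blue_triCell, left] using ha.1, by simpa [left] using ha.2⟩
    have step : ∀ a ∈ {v | ω v = true} ∩ D, ∀ c ∈ {v | ω v = true} ∩ D,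
        Adj4 (2 * a.1 + a.2 + 1, a.2) (2 * c.1 + c.2, c.2) →
        Joined Adj4 (blue triCell ω ∩ brick ⁻¹' D) (2 * a.1 + a.2, a.2) (2 * c.1 + c.2, c.2) := by
      intro a ha c hc hac
      have h1 : Adj4 (2 * a.1 + a.2, a.2) (2 * a.1 + a.2 + 1, a.2) := Or.inl ⟨rfl, Or.inr rfl⟩
      refine ((Joined.refl (B := blue triCell ω ∩ brick ⁻¹' D) ⟨?_, ?_⟩).tail h1 ⟨?_, ?_⟩).tail
        hac ⟨?_, ?_⟩
      · simpa [mem_blue_triCell, left] using ha.1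
      · simpa [left] using ha.2
      · simpa [mem_blue_triCell, right] using ha.1
      · simpa [right] using ha.2
      · simpa [mem_blue_triCell, left] using hc.1
      · simpa [left] using hc.2
    intro a ha c hc hac
    rw [triangularLattice_adj] at hac
    by_cases h1 : Adj4 (2 * a.1 + a.2 + 1, a.2) (2 * c.1 + c.2, c.2)
    · exact step a ha c hc h1
    · refine (step c hc a ha ?_).symm4
      unfold Adj4 at *
      simp only at *
      omega
  · rintro ⟨x, hx, y, hy, h⟩
    refine ⟨brick x, hx, brick y, hy, h.map brick (fun z hz => hz) fun u hu v hv huv => ?_⟩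
    by_cases heq : brick u = brick v
    · rw [heq]
      exact .refl hv
    · refine .single hu ?_ hv
      rw [triangularLattice_adj]
      simp only [brick, Prod.ext_iff] at *
      unfold Adj4 at huv
      omega

lemma mem_siteCrossing_iff {m n : ℕ} {ω : ℤ × ℤ → Bool} :
    ω ∈ siteCrossing m n ↔ ∃ x ∈ {x : ℤ × ℤ | x.1 = 0}, ∃ y ∈ {y : ℤ × ℤ | y.1 = m},
      Joined triangularLattice.Adj ({v | ω v = true} ∩ rectangle m n) x y := by
  constructor
  · rintro ⟨x, y, w, hx, hy, hw⟩
    refine ⟨x, hx, y, hy, ?_⟩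
    have := (exists_walk_iff_joined triangularLattice (fun _ => True)
      (S := {v | ω v = true} ∩ rectangle m n)).mp ⟨w, fun v hv => ⟨(hw v hv).2, (hw v hv).1⟩, fun _ _ => trivial⟩
    exact this.map id (fun _ h => h) fun a ha c hc hac => .single ha hac.1 hc
  · rintro ⟨x, hx, y, hy, h⟩
    have h' : Joined (fun x y => triangularLattice.Adj x y ∧ True)
        ({v | ω v = true} ∩ rectangle m n) x y :=
      h.map id (fun _ h => h) fun a ha c hc hac => .single ha ⟨hac, trivial⟩ hc
    obtain ⟨w, hw, -⟩ := (exists_walk_iff_joined triangularLattice (fun _ => True)).mpr h'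
    exact ⟨x, y, w, hx, hy, fun v hv => (hw v hv).symm⟩

lemma crossingProb_triangularSite (p : I) (m n : ℕ) :
    crossingProb .triangularSite p m n = pr p triCell (Joins (brick ⁻¹' rectangle m n)
      (brick ⁻¹' {x | x.1 = 0}) (brick ⁻¹' {x | x.1 = m})) := by
  simp only [crossingProb, pr]
  congr 1
  ext ω
  rw [mem_siteCrossing_iff, exists_joined_sites_iff]
  rfl

/-- Transposition of the coordinates is a symmetry of the triangular lattice. -/
lemma crossingProb_triangularSite_eq_vertical (p : I) (n : ℕ) :
    crossingProb .triangularSite p n n = pr p triCell (Joins (brick ⁻¹' rectangle n n)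
      (brick ⁻¹' {x | x.2 = 0}) (brick ⁻¹' {x | x.2 = n})) := by
  simp only [crossingProb, pr]
  rw [← productLaw_real_comp (Equiv.prodComm _ _)]
  congr 1
  ext ω
  simp only [Set.mem_ofPred_eq]
  rw [mem_siteCrossing_iff, ← exists_joined_sites_iff]
  have hadj : ∀ u v : ℤ × ℤ, triangularLattice.Adj u v → triangularLattice.Adj u.swap v.swap := by
    intro u v
    simp only [triangularLattice_adj, Prod.fst_swap, Prod.snd_swap]
    omega
  constructor
  · rintro ⟨x, hx, y, hy, h⟩
    have hD : ∀ a ∈ {v | (ω ∘ Equiv.prodComm ℤ ℤ) v = true} ∩ rectangle n n,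
        a.swap ∈ {v | ω v = true} ∩ rectangle n n := fun a ha => ⟨ha.1, ha.2.2, ha.2.1⟩
    exact ⟨x.swap, hx, y.swap, hy, h.map Prod.swap hD fun u hu v hv huv =>
      .single (hD u hu) (hadj u v huv) (hD v hv)⟩
  · rintro ⟨x, hx, y, hy, h⟩
    have hD : ∀ a ∈ {v | ω v = true} ∩ rectangle n n,
        a.swap ∈ {v | (ω ∘ Equiv.prodComm ℤ ℤ) v = true} ∩ rectangle n n :=
      fun a ha => ⟨ha.1, ha.2.2, ha.2.1⟩
    exact ⟨x.swap, hx, y.swap, hy, h.map Prod.swap hD fun u hu v hv huv =>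
      .single (hD u hu) (hadj u v huv) (hD v hv)⟩

lemma mem_brick_rectangle {m n : ℕ} {z : ℤ × ℤ} :
    z ∈ brick ⁻¹' rectangle m n ↔ (z.2 ≤ z.1 ∧ z.1 ≤ z.2 + 2 * m + 1) ∧ 0 ≤ z.2 ∧ z.2 ≤ n := by
  simp only [Set.mem_preimage, brick, rectangle, Set.mem_ofPred_eq]
  omega

/-- A crossing of a rhombus crosses the rectangle which is left after cutting off two triangles. -/
lemma horBound_of_crossingProb {j : ℕ} (hj : 2 ≤ j)
    (h : δ ≤ crossingProb .triangularSite p j j) : HorBound p triCell δ (j - 2) j := by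
  rw [crossingProb_triangularSite] at h
  have := horBound_triCell (x₀ := j + 1) (x₁ := 2 * j) (y₀ := 0) (y₁ := j) (by omega)
    (h.trans (pr_mono (Ψ := HCross (j + 1) (2 * j) 0 j) ?_))
  · exact this.mono (by omega) (by omega) (by omega)
  rintro b ⟨u, hu, v, hv, huv⟩
  have hu' := huv.left_mem.2
  have hv' := huv.right_mem.2
  rw [mem_brick_rectangle] at hu' hv'
  simp only [Set.mem_preimage, brick, Set.mem_ofPred_eq] at hu hv
  obtain ⟨u', v', hu', hv', hj⟩ := huv.slab (c := (j : ℤ) + 1) (d := 2 * j)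
    (fun _ _ => Adj4.symm) Prod.fst
    (fun a c h => by unfold Adj4 at h; omega) (by omega) (by omega) (by omega)
  refine ⟨u', hu', v', hv', hj.mono ?_⟩
  rintro z ⟨⟨hzb, hzD⟩, hz, hz'⟩
  rw [mem_brick_rectangle] at hzD
  refine ⟨hzb, ?_⟩
  rw [mem_box]
  omega

lemma le_pr_vCross_of_crossingProb {j : ℕ}
    (h : δ ≤ crossingProb .triangularSite p j j) :
    δ ≤ pr p triCell (VCross 0 (3 * j + 1) 0 j) := by
  rw [crossingProb_triangularSite_eq_vertical] at h
  refine h.trans (pr_mono ?_)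
  rintro b ⟨u, hu, v, hv, huv⟩
  refine ⟨u, hu, v, hv, huv.mono ?_⟩
  rintro z ⟨hzb, hzD⟩
  rw [mem_brick_rectangle] at hzD
  refine ⟨hzb, ?_⟩
  rw [mem_box]
  omega

/-- By transposition, rhombi are crossed vertically; but as sets of cells they are as wide as three
times their height. -/
lemma verBound_of_crossingProb {j : ℕ}
    (h : δ ≤ crossingProb .triangularSite p j j) : VerBound p triCell δ (3 * j + 2) j := by
  have := verBound_triCell (le_pr_vCross_of_crossingProb h)
  exact this.mono (by omega) (by omega) (by omega)

/-- A long enough horizontal crossing cuts off a crossing of a rhombus. -/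
lemma HorBound.le_crossingProb {W H : ℤ} {N : ℕ} (h : HorBound p triCell δ W H)
    (hHN : H ≤ N) (hW : 3 * N + 1 ≤ W) : δ ≤ crossingProb .triangularSite p N N := by
  rw [crossingProb_triangularSite]
  refine (h 0 0).trans (pr_mono ?_)
  rintro b ⟨u, hu, v, hv, huv⟩
  have hu' := huv.left_mem.2
  have hv' := huv.right_mem.2
  rw [mem_box] at hu' hv'
  simp only [Set.mem_ofPred_eq] at hu hv
  obtain ⟨u', v', hu', hv', hj⟩ := huv.slab (c := 0) (d := 2 * N)
    (fun _ _ => Adj4.symm) (fun z => z.1 - z.2)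
    (fun a c h => by unfold Adj4 at h; omega) (by omega) (by omega) (by omega)
  refine ⟨u', ?_, v', ?_, hj.mono ?_⟩
  · simp only [Set.mem_preimage, brick, Set.mem_ofPred_eq]; omega
  · simp only [Set.mem_preimage, brick, Set.mem_ofPred_eq]; omega
  rintro z ⟨⟨hzb, hzD⟩, hz, hz'⟩
  rw [mem_box] at hzD
  refine ⟨hzb, ?_⟩
  rw [mem_brick_rectangle]
  omega

/-- The rhombus contains a square of `N × N` cells. -/
lemma VerBound.le_crossingProb {W H : ℤ} {N : ℕ} (h : VerBound p triCell δ H W)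
    (hHN : H ≤ N) (hW : N ≤ W) : δ ≤ crossingProb .triangularSite p N N := by
  rw [crossingProb_triangularSite_eq_vertical]
  refine (h.mono le_rfl (by omega) hW N 0).trans (pr_mono ?_)
  rintro b ⟨u, hu, v, hv, huv⟩
  refine ⟨u, hu, v, by simpa [brick] using hv, huv.mono ?_⟩
  rintro z ⟨hzb, hzD⟩
  rw [mem_box] at hzD
  refine ⟨hzb, ?_⟩
  rw [mem_brick_rectangle]
  omega

/-- A vertical crossing of a rectangle is contained in a strip of width `15 q`, or it contains a
horizontal crossing of a strip of width `14 q`: up to multiples of `q`, the strips start at the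
leftmost column of the path. -/
lemma VCross.exists_strip {q : ℕ} {h : ℤ} {b : Set (ℤ × ℤ)} (hq : 2 ≤ q)
    (hb : VCross 0 (24 * q + 1) 0 h b) :
    ∃ i ∈ Finset.range 25, VCross (i * q) ((i + 15) * q) 0 h b ∨
      HCross ((i + 1) * q) ((i + 15) * q) 0 h b := by
  classical
  obtain ⟨u, hu, v, hv, huv⟩ := hb
  set S := {z | Joined Adj4 (b ∩ box 0 (24 * q + 1) 0 h) u z} with hS
  have hSbox : ∀ z ∈ S, z ∈ b ∧ z ∈ box 0 (24 * q + 1) 0 h := fun z hz => hz.right_mem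
  have hub := (hSbox u (.refl huv.left_mem)).2
  rw [mem_box] at hub
  have hex : ∃ i : ℕ, ∃ z ∈ S, z.1 < (i + 1) * q :=
    ⟨24, u, .refl huv.left_mem, by push_cast; omega⟩
  set i := Nat.find hex with hi
  obtain ⟨z, hz, hzi⟩ := Nat.find_spec hex
  rw [← hi] at hzi
  have hi25 : i < 25 := Nat.lt_succ_of_le
    (Nat.find_min' hex ⟨u, .refl huv.left_mem, by push_cast; omega⟩)
  have hmin : ∀ y ∈ S, (i : ℤ) * q ≤ y.1 := by
    intro y hy
    rcases Nat.eq_zero_or_pos i with h0 | h0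
    · rw [h0]
      have := (hSbox y hy).2.1.1
      simpa using this
    · have h1 := Nat.find_min hex (m := i - 1) (by omega)
      push Not at h1
      have h2 := h1 y hy
      rwa [show ((i - 1 : ℕ) : ℤ) + 1 = i by omega] at h2
  refine ⟨i, Finset.mem_range.mpr hi25, ?_⟩
  by_cases hmax : ∀ y ∈ S, y.1 ≤ ((i : ℤ) + 15) * q
  · refine Or.inl ⟨u, hu, v, hv, huv.cluster.mono fun y hy => ?_⟩
    have h1 := (hSbox y hy).2
    rw [mem_box] at h1
    exact ⟨(hSbox y hy).1, ⟨hmin y hy, hmax y hy⟩, h1.2⟩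
  · push Not at hmax
    obtain ⟨y, hy, hyi⟩ := hmax
    obtain ⟨u', v', hu', hv', hj⟩ := (hz.symm4.trans hy).slab (fun _ _ => Adj4.symm) Prod.fst
      (fun a c h => by unfold Adj4 at h; omega)
      (show ((i : ℤ) + 1) * q ≤ (i + 15) * q by gcongr; norm_num) hzi.le hyi.le
    refine Or.inr ⟨u', hu', v', hv', hj.mono ?_⟩
    rintro a ⟨⟨hab, haD⟩, ha, ha'⟩
    exact ⟨hab, ⟨ha, ha'⟩, haD.2⟩

lemma horBound_or_verBound {q : ℕ} {h : ℤ} (hq : 2 ≤ q)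
    (hV : δ ≤ pr p triCell (VCross 0 (24 * q + 1) 0 h)) :
    HorBound p triCell (δ / 50) (14 * q - 1) h ∨ VerBound p triCell (δ / 50) (15 * q + 1) h := by
  by_contra hcon
  rw [not_or] at hcon
  have hV' := hV.trans ((pr_mono fun b hb => hb.exists_strip hq).trans
    (pr_exists_le (Finset.range 25) _))
  refine absurd hV' (not_le.mpr ?_)
  calc _ < ∑ i ∈ Finset.range 25, (δ / 50 + δ / 50) := by
        refine Finset.sum_lt_sum_of_nonempty (by simp) fun i _ => ?_
        refine pr_or_le.trans_lt (add_lt_add ?_ ?_)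
        · by_contra hi
          have := verBound_triCell (not_lt.mp hi)
          rw [sub_zero, show ((i : ℤ) + 15) * q - i * q + 1 = 15 * q + 1 by ring] at this
          exact hcon.2 this
        · by_contra hi
          have := horBound_triCell (by gcongr; norm_num) (not_lt.mp hi)
          rw [sub_zero, show ((i : ℤ) + 15) * q - (i + 1) * q - 1 = 14 * q - 1 by ring] at this
          exact hcon.1 this
    _ = δ := by simp; ring

/-- Crossings of larger rhombi in site percolation. A vertical crossing of a rectangle yields a
rather narrow vertical or a rather long horizontal crossing, which can be lengthened. The strips of
`VCross.exists_strip` are used with `q = 2 r` and the height `16 r`: there `14 q = 28 r` exceeds the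
width `24 r + 2` for which vertical crossings of height `8 r` are at hand, and `16 r` exceeds the
height, about `15 r`, for which horizontal crossings of length `15 r` are at hand. -/
lemma crossingProb_triangularSite_ge (δ : ℝ) (hδ : 0 < δ) (K : ℕ) :
    ∃ c > 0, ∃ n₀ : ℕ, ∀ p : I, ∀ n : ℕ, n₀ ≤ n →
      (∀ j : ℕ, 1 ≤ j → j ≤ n → δ ≤ crossingProb .triangularSite p j j) →
      ∀ N : ℕ, n < N → N ≤ K * (n + 1) → c ≤ crossingProb .triangularSite p N N := by
  obtain ⟨i, hi⟩ : ∃ i : ℕ, 240 * K ≤ 2 ^ i := ⟨240 * K, Nat.lt_two_pow_self.le⟩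
  refine ⟨lengthenConst (δ / 50) δ i, lengthenConst_pos (by positivity) hδ i, 90,
    fun p n hn h N hnN hN => ?_⟩
  obtain ⟨r, hr⟩ : ∃ r : ℕ, r = n / 30 := ⟨_, rfl⟩
  have h4 : 4 * N ≤ 2 ^ i * r := by
    calc 4 * N ≤ 4 * (K * (n + 1)) := by omega
      _ ≤ 4 * (K * (60 * r)) := by gcongr; omega
      _ = 240 * K * r := by ring
      _ ≤ _ := by gcongr
  have h5 : (4 * N : ℤ) ≤ 2 ^ i * r := by exact_mod_cast h4
  have hV := le_pr_vCross_of_crossingProb (h (16 * r) (by omega) (by omega))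
  rw [show (3 * (16 * r : ℕ) + 1 : ℤ) = 24 * (2 * r : ℕ) + 1 by push_cast; ring] at hV
  rcases horBound_or_verBound (by omega) hV with hb | hb
  · have h2 := verBound_of_crossingProb (h (8 * r) (by omega) (by omega))
    have h3 := HorBound.lengthen_iterate (d := 4 * r - 3) (w := 24 * r + 2) (k := 8 * r) (s := 0)
      clustered_triCell (Or.inl rfl) isSymmetry_triCell_rowReflection (by positivity) hδ
      (by omega) (by omega) (by omega)
      (hb.mono (by omega) (by push_cast; omega) (by push_cast; omega))
      (h2.mono (by push_cast; omega) (by omega) (by push_cast; omega)) i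
    refine h3.le_crossingProb (by omega) ?_
    have h6 : (2 : ℤ) ^ i * r ≤ 2 ^ i * (4 * r - 3) := by
      gcongr
      omega
    omega
  · have h2 := horBound_of_crossingProb (by omega) (h (15 * r + 2) (by omega) (by omega))
    have h3 := HorBound.lengthen_iterate (d := r - 2) (w := 15 * r + 2) (k := 15 * r) (s := 1)
      clustered_triCell_swap (Or.inr rfl) isSymmetry_triCell_swap_rowReflection (by positivity) hδ
      (by omega) (by omega) (by omega)
      (hb.swap.mono (by omega) (by push_cast; omega) (by push_cast; omega))
      (h2.swap.mono (by push_cast; omega) (by omega) (by push_cast; omega)) i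
    refine VerBound.le_crossingProb h3.swap (by omega) ?_
    have h6 : (2 : ℤ) ^ i * r ≤ 2 ^ i * (3 * (r - 2)) := by
      gcongr
      omega
    rw [mul_left_comm] at h6
    omega

lemma crossingProb_triangularSite_one_le (p : I) : crossingProb .triangularSite p 1 1 ≤ 2 * p := by
  calc _ ≤ (productLaw (ℤ × ℤ) p).real ({ω | ω (0, 0) = true} ∪ {ω | ω (0, 1) = true}) := by
        refine measureReal_mono ?_
        rintro ω ⟨x, y, w, hx, -, hw⟩
        obtain ⟨⟨-, h1, h2⟩, h3⟩ := hw x w.start_mem_support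
        obtain ⟨a, c⟩ := x
        simp only at hx h1 h2
        subst hx
        have : c = 0 ∨ c = 1 := by omega
        rcases this with rfl | rfl
        exacts [Or.inl h3, Or.inr h3]
    _ ≤ p + p := (measureReal_union_le _ _).trans
        (by rw [productLaw_real_true, productLaw_real_true])
    _ = 2 * p := by ring

lemma pow_le_crossingProb_triangularSite (p : I) (N : ℕ) :
    (p : ℝ) ^ (2 * N + 1) ≤ crossingProb .triangularSite p N N := by
  rw [crossingProb_triangularSite]
  refine (pow_le_pr_hCross (π := triCell) (fun x => (pr_mem_eq rfl).ge) (2 * N)).trans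
    (pr_mono ?_)
  rintro b ⟨u, hu, v, hv, huv⟩
  have hu' := huv.left_mem.2
  have hv' := huv.right_mem.2
  rw [mem_box] at hu' hv'
  simp only [Set.mem_ofPred_eq] at hu hv
  refine ⟨u, ?_, v, ?_, huv.mono ?_⟩
  · simp only [Set.mem_preimage, brick, Set.mem_ofPred_eq]; omega
  · simp only [Set.mem_preimage, brick, Set.mem_ofPred_eq]; omega
  rintro z ⟨hzb, hzD⟩
  rw [mem_box] at hzD
  refine ⟨hzb, ?_⟩
  rw [mem_brick_rectangle]
  omega

end Triangular

/-! ### Characteristic lengths -/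

lemma crossingProb_ge (M : Model) (δ : ℝ) (hδ : 0 < δ) (K : ℕ) :
    ∃ c > 0, ∃ n₀ : ℕ, ∀ p : I, ∀ n : ℕ, n₀ ≤ n →
      (∀ j : ℕ, 1 ≤ j → j ≤ n → δ ≤ crossingProb M p j j) →
      ∀ N : ℕ, n < N → N ≤ K * (n + 1) → c ≤ crossingProb M p N N := by
  cases M
  · exact crossingProb_triangularSite_ge δ hδ K
  · exact crossingProb_squareBond_ge δ hδ K

lemma crossingProb_one_le (M : Model) (p : I) : crossingProb M p 1 1 ≤ 2 * p := by
  cases M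
  · exact crossingProb_triangularSite_one_le p
  · exact crossingProb_squareBond_one_le p

lemma pow_le_crossingProb (M : Model) (p : I) (N : ℕ) :
    (p : ℝ) ^ (2 * N + 1) ≤ crossingProb M p N N := by
  cases M
  · exact pow_le_crossingProb_triangularSite p N
  · exact pow_le_crossingProb_squareBond p N

variable {M : Model} {p : I} {ε : ℝ}

lemma charLength_of_lt (hp : (p : ℝ) < pc) : charLength M ε p =
    sInf {N : ℕ∞ | ∃ n : ℕ, 1 ≤ n ∧ crossingProb M p n n ≤ ε ∧ N = n} := by
  unfold charLength
  rw [if_pos hp]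

lemma lt_crossingProb_of_lt_charLength (hp : (p : ℝ) < pc) {n : ℕ} (hn : 1 ≤ n)
    (h : (n : ℕ∞) < charLength M ε p) : ε < crossingProb M p n n := by
  rw [charLength_of_lt hp] at h
  by_contra hc
  refine absurd (sInf_le ?_) (not_le.mpr h)
  exact ⟨n, hn, not_lt.mp hc, rfl⟩

/-- Lower bounds for a characteristic length come from lower bounds for crossing probabilities. -/
lemma le_charLength (hp : (p : ℝ) < pc) {x : ℝ≥0∞}
    (h : ∀ N : ℕ, 1 ≤ N → (N : ℝ≥0∞) < x → ε < crossingProb M p N N) :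
    x ≤ (charLength M ε p : ℝ≥0∞) := by
  rcases Set.eq_empty_or_nonempty
    {N : ℕ∞ | ∃ n : ℕ, 1 ≤ n ∧ crossingProb M p n n ≤ ε ∧ N = n} with he | hne
  · rw [charLength_of_lt hp, he, sInf_empty]
    exact le_top
  · obtain ⟨n, hn, hnε, hN⟩ := csInf_mem hne
    rw [charLength_of_lt hp, hN]
    by_contra hc
    exact absurd (h n hn (by simpa using hc)) (not_lt.mpr hnε)

end Percolation

theorem lemma6 (M : Percolation.Model) (ε₀ : ℝ) (hε₀ : 0 < ε₀ ∧ ε₀ < 1 / 2)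
    (K : ℝ) (hK : 1 ≤ K) (p₀ : ℝ) (hp₀ : 0 < p₀ ∧ p₀ < Percolation.pc) :
    ∃ ε : ℝ, 0 < ε ∧ ε < ε₀ ∧
      ∀ p : I, 0 < (p : ℝ) → (p : ℝ) < Percolation.pc →
        (p₀ ≤ (p : ℝ) ∨ 1 < Percolation.charLength M ε₀ p) →
        ENNReal.ofReal K * (Percolation.charLength M ε₀ p : ℝ≥0∞) ≤
          (Percolation.charLength M ε p : ℝ≥0∞) := by
  obtain ⟨hε, -⟩ := hε₀
  obtain ⟨hp₀, -⟩ := hp₀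
  obtain ⟨k, hk⟩ := exists_nat_ge K
  obtain ⟨c, hc, n₀, hRSW⟩ := Percolation.crossingProb_ge M ε₀ hε k
  -- the given condition keeps `p` away from zero
  set p₁ := min p₀ (ε₀ / 2) with hp₁
  have hp₁0 : 0 < p₁ := lt_min hp₀ (by positivity)
  set c' := p₁ ^ (2 * (k * (n₀ + 1)) + 1) with hc'
  have hc'0 : 0 < c' := by positivity
  refine ⟨min ε₀ (min c c') / 2, by positivity,
    (half_lt_self (by positivity)).trans_le (min_le_left _ _), fun p hp0 hp h => ?_⟩
  have hεlt : min ε₀ (min c c') / 2 < min ε₀ (min c c') := half_lt_self (by positivity)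
  have hp₁p : p₁ ≤ p := by
    rcases h with h | h
    · exact (min_le_left _ _).trans h
    · have h1 := Percolation.lt_crossingProb_of_lt_charLength hp le_rfl (by exact_mod_cast h)
      have h2 := Percolation.crossingProb_one_le M p
      exact (min_le_right _ _).trans (by linarith)
  refine Percolation.le_charLength hp fun N hN hNx => hεlt.trans_le ?_
  by_cases hNL : (N : ℕ∞) < Percolation.charLength M ε₀ p
  · exact (min_le_left _ _).trans (Percolation.lt_crossingProb_of_lt_charLength hp hN hNL).le
  refine (min_le_right _ _).trans ?_
  rw [not_lt] at hNL
  obtain ⟨L, hL⟩ := ENat.ne_top_iff_exists.mp (ne_top_of_le_ne_top (ENat.natCast_ne_top N) hNL)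
  rw [← hL] at hNL hNx
  have hL1 : 1 ≤ L := by
    by_contra h0
    have h0 : L = 0 := by omega
    rw [h0] at hNx
    simp at hNx
  obtain ⟨n, rfl⟩ : ∃ n, L = n + 1 := ⟨L - 1, by omega⟩
  have hnN : n < N := by exact_mod_cast hNL
  have hNk : N ≤ k * (n + 1) := by
    have h1 : ENNReal.ofReal K ≤ (k : ℝ≥0∞) := by
      rw [← ENNReal.ofReal_natCast]
      exact ENNReal.ofReal_le_ofReal hk
    have h2 : (N : ℝ≥0∞) < k * ((n + 1 : ℕ) : ℝ≥0∞) := by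
      refine hNx.trans_le ?_
      simp only [ENat.toENNReal_coe]
      gcongr
    exact_mod_cast h2.le
  rcases le_or_gt n₀ n with hn | hn
  · refine (min_le_left _ _).trans (hRSW p n hn (fun j hj hjn => ?_) N hnN hNk)
    refine (Percolation.lt_crossingProb_of_lt_charLength hp hj ?_).le
    rw [← hL]
    exact_mod_cast Nat.lt_succ_of_le hjn
  · refine (min_le_right _ _).trans (le_trans ?_ (Percolation.pow_le_crossingProb M p N))
    calc c' ≤ (p : ℝ) ^ (2 * (k * (n₀ + 1)) + 1) :=
        pow_le_pow_left₀ hp₁0.le hp₁p _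
      _ ≤ _ := by
        refine pow_le_pow_of_le_one p.2.1 p.2.2 ?_
        have : k * (n + 1) ≤ k * (n₀ + 1) := by gcongr
        omega
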